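/- **Hochschild homology.** For a bicategory $\mathscr B$ let $\mathrm{biHH}(\mathscr B)$ be the pseudo-colimit (in the $2$-category of categories) of the $2$-truncated pseudo-simplicial diagram $$\coprod_{X_0}\mathscr B(X_0,X_0)\;\leftleftarrows\;\coprod_{X_0,X_1}\mathscr B(X_0,X_1)\times\mathscr B(X_1,X_0)\;\Lleftarrow\;\coprod_{X_0,X_1,X_2}\mathscr B(X_0,X_1)\times\mathscr B(X_1,X_2)\times\mathscr B(X_2,X_0)$$ with faces $d_0(F,G)=FG$, $d_1(F,G)=GF$ and $d_0(F,G,H)=(FG,H)$, $d_1(F,G,H)=(F,GH)$, $d_2(F,G,H)=(HF,G)$, whose degeneracies insert unit $1$-morphisms. Explicitly, it is realized by the category whose objects are the $1$-endomorphisms of $\mathscr B$ and whose morphisms are generated by the $2$-morphisms between them and by isomorphisms $(F,G)\colon FG\cong GF$ for $F\colon X\to Y$, $G\colon Y\to X$, subject to: the generators from $2$-morphisms compose as in $\mathscr B$; $(F,G)$ is natural in $F$ and $G$; and, up to associators and unitors, $(F,GH)=(HF,G)\circ(FG,H)$ and $(F,U)=\mathrm{id}$ for the unit $U$. That this category is the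 pseudo-colimit means that for every category $\mathscr V$ the canonical functor from $\mathrm{Fun}(\mathrm{biHH}(\mathscr B),\mathscr V)$ to the category of pseudo-cocones with vertex $\mathscr V$ under the diagram is an equivalence; this is part (0) of the statement. **AdjEnd.** Let $\mathscr{A}\mathrm{dj}\mathscr{E}\mathrm{nd}$ be the free $2$-category on two objects $0,1$, an adjunction $f\dashv g$ with $f\colon 0\to 1$, unit $u\colon 1\to gf$, counit $c\colon fg\to 1$ (satisfying the triangle identities), and an additional free endomorphism $q\colon 0\to 0$. In $\mathrm{biHH}(\mathscr{A}\mathrm{dj}\mathscr{E}\mathrm{nd})$ let $\varnothing_1$ be the object $q$, let $[0]_1$ be the object $gfq$, and let $\iota\colon\varnothing_1\to[0]_1$ be the morphism induced by $u$. **Functors.** For bicategories $\mathscr A,\mathscr B$ let $\mathrm{Fun}(\mathscr A,\mathscr B)$ be the category whose objects are the pseudofunctors $\mathscr A\to\mathscr B$ and whose morphisms are the isomorphism classes of oplax natural transformations all of whose components are left adjoints. $\mathrm{biHH}$ induces a functor $\mathrm{Fun}(\mathscr A,\mathscr B)\to\mathrm{Fun}(\mathrm{biHH}(\mathscr A),\mathrm{biHH}(\mathscr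 B))$, and hence every morphism $m$ of $\mathrm{biHH}(\mathscr A)$ induces a restriction functor $m^*\colon\mathrm{Fun}(\mathscr A,\mathscr B)\to\mathscr{A}\mathrm{rr}(\mathrm{biHH}(\mathscr B))$, $P\mapsto\mathrm{biHH}(P)(m)$. Put $\mathscr{A}\mathrm{dj}\mathscr{E}\mathrm{nd}(\mathscr B)=\mathrm{Fun}(\mathscr{A}\mathrm{dj}\mathscr{E}\mathrm{nd},\mathscr B)$. The trace functor $\widehat{\mathrm{tr}}\colon\mathscr{A}\mathrm{dj}\mathscr{E}\mathrm{nd}(\mathscr B)\to\mathscr{A}\mathrm{rr}(\mathrm{biHH}(\mathscr B))$ sends a pseudofunctor, given by an adjunction $F\dashv G$ with $F\colon C\to D$, unit $u$, counit $c$, and an endomorphism $Q\colon C\to C$, to $$Q\xrightarrow{\;uQu\;}GFQGF\;\cong\;FQGFG\xrightarrow{\;FQGc\;}FQG ,$$ where the isomorphism rotates the first letter $G$ to the end, and sends a transformation to the square that it induces on $\mathrm{biHH}$. **Corollary.** 0. For every bicategory $\mathscr B$, the category $\mathrm{biHH}(\mathscr B)$ described above, with its canonical pseudo-cocone, is the pseudo-colimit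 of the diagram. 1. The trace functor is obtained by restricting to $\iota\colon\varnothing_1\to[0]_1$: with $\kappa\colon[0]_1=gfq\cong fqg$ the rotation of the letter $g$, the composite $q\to gfqgf\cong fqgfg\to fqg$ in $\mathrm{biHH}(\mathscr{A}\mathrm{dj}\mathscr{E}\mathrm{nd})$ equals $\kappa\circ\iota$, and for every bicategory $\mathscr B$ there is a natural isomorphism $\widehat{\mathrm{tr}}\cong\iota^*$ that is the identity on sources and, at a pseudofunctor $P$, is $\mathrm{biHH}(P)(\kappa^{-1})$ on targets (up to the comparison isomorphism $P(fqg)\cong FQG$). 2. $\mathrm{Aut}(\varnothing_1)\cong\mathbb Z$. 3. The morphism $\varnothing_1\to[0]_1$, and hence the trace, is determined only up to a choice of automorphism: for every morphism $m\colon\varnothing_1\to[0]_1$ there is exactly one $\alpha\in\mathrm{Aut}(\varnothing_1)$ with $m=\iota\circ\alpha$. 4. Every morphism $q\to fqg$ of $\mathrm{biHH}(\mathscr{A}\mathrm{dj}\mathscr{E}\mathrm{nd})$ is of the form $q\xrightarrow{uqu}gfqgf\xrightarrow{j}fqgfg\xrightarrow{fqgc}fqg$ for some isomorphism $j$ of $\mathrm{biHH}(\mathscr{A}\mathrm{dj}\mathscr{E}\mathrm{nd})$.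 5. The choice matters: already for $\mathscr B=\mathscr{A}\mathrm{dj}\mathscr{E}\mathrm{nd}$, different automorphisms $\alpha$ of $\varnothing_1$ give different functors $(\iota\circ\alpha)^*$. -/

import Mathlib

open CategoryTheory Bicategory

universe w v u w' v' u' v'' u''

/-- Hochschild homology `biHH(B)` of a bicategory `B`: the pseudo-colimit of the cyclic bar
construction of `B`, realized as the category with the following presentation. An object is a
`1`-endomorphism `loop : pt ⟶ pt` of `B`; the morphisms are generated by the `2`-morphisms of `B`
and by isomorphisms `(F, G) : F ≫ G ≅ G ≫ F`. -/
structure BiHH (B : Type u) [Bicategory.{w, v} B] where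
  /-- the object of `B` at which the loop is based -/
  pt : B
  /-- the loop -/
  loop : pt ⟶ pt

namespace BiHH

section Presentation

variable {B : Type u} [Bicategory.{w, v} B]

/-- Formal composites of the generating morphisms of `biHH(B)`: the `2`-morphisms between
`1`-endomorphisms, and the symbols `(F, G) : F ≫ G → G ≫ F` together with their inverses. -/
inductive Expr : BiHH B → BiHH B → Type (max u v w)
  | id (x : BiHH B) : Expr x x
  | comp {x y z : BiHH B} : Expr x y → Expr y z → Expr x z
  | cell {X : B} {F G : X ⟶ X} (α : F ⟶ G) : Expr ⟨X, F⟩ ⟨X, G⟩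
  | rot {X Y : B} (F : X ⟶ Y) (G : Y ⟶ X) : Expr ⟨X, F ≫ G⟩ ⟨Y, G ≫ F⟩
  | rotInv {X Y : B} (F : X ⟶ Y) (G : Y ⟶ X) : Expr ⟨Y, G ≫ F⟩ ⟨X, F ≫ G⟩

/-- The relations of `biHH(B)`. -/
inductive Rel : ∀ {x y : BiHH B}, Expr x y → Expr x y → Prop
  | comp_left {x y z : BiHH B} (a : Expr x y) {b b' : Expr y z} :
      Rel b b' → Rel (a.comp b) (a.comp b')
  | comp_right {x y z : BiHH B} {a a' : Expr x y} (b : Expr y z) :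
      Rel a a' → Rel (a.comp b) (a'.comp b)
  | id_comp {x y : BiHH B} (a : Expr x y) : Rel ((Expr.id x).comp a) a
  | comp_id {x y : BiHH B} (a : Expr x y) : Rel (a.comp (Expr.id y)) a
  | assoc {x y z t : BiHH B} (a : Expr x y) (b : Expr y z) (c : Expr z t) :
      Rel ((a.comp b).comp c) (a.comp (b.comp c))
  | cell_id {X : B} (F : X ⟶ X) : Rel (Expr.cell (𝟙 F)) (Expr.id ⟨X, F⟩)
  | cell_comp {X : B} {F G H : X ⟶ X} (α : F ⟶ G) (β : G ⟶ H) :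
      Rel (Expr.cell (α ≫ β)) ((Expr.cell α).comp (Expr.cell β))
  | rot_rotInv {X Y : B} (F : X ⟶ Y) (G : Y ⟶ X) :
      Rel ((Expr.rot F G).comp (Expr.rotInv F G)) (Expr.id ⟨X, F ≫ G⟩)
  | rotInv_rot {X Y : B} (F : X ⟶ Y) (G : Y ⟶ X) :
      Rel ((Expr.rotInv F G).comp (Expr.rot F G)) (Expr.id ⟨Y, G ≫ F⟩)
  | rot_naturality {X Y : B} {F F' : X ⟶ Y} {G G' : Y ⟶ X} (α : F ⟶ F') (β : G ⟶ G') :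
      Rel ((Expr.cell (α ▷ G ≫ F' ◁ β)).comp (Expr.rot F' G'))
        ((Expr.rot F G).comp (Expr.cell (β ▷ F ≫ G' ◁ α)))
  | rot_comp {X Y Z : B} (F : X ⟶ Y) (G : Y ⟶ Z) (H : Z ⟶ X) :
      Rel (Expr.rot F (G ≫ H))
        ((Expr.cell (α_ F G H).inv).comp ((Expr.rot (F ≫ G) H).comp
          ((Expr.cell (α_ H F G).inv).comp ((Expr.rot (H ≫ F) G).comp
            (Expr.cell (α_ G H F).inv)))))
  | rot_id {X : B} (F : X ⟶ X) :
      Rel ((Expr.rot F (𝟙 X)).comp (Expr.cell (λ_ F).hom)) (Expr.cell (ρ_ F).hom)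

instance : Category.{max u v w} (BiHH B) where
  Hom x y := Quot (@Rel B _ x y)
  id x := Quot.mk _ (Expr.id x)
  comp := Quot.map₂ Expr.comp (fun a _ _ => Rel.comp_left a) (fun _ _ b => Rel.comp_right b)
  id_comp := by
    rintro x y ⟨a⟩
    exact Quot.sound (Rel.id_comp a)
  comp_id := by
    rintro x y ⟨a⟩
    exact Quot.sound (Rel.comp_id a)
  assoc := by
    rintro x y z t ⟨a⟩ ⟨b⟩ ⟨c⟩
    exact Quot.sound (Rel.assoc a b c)

/-- The object of `biHH(B)` given by a `1`-endomorphism. -/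
abbrev of {X : B} (F : X ⟶ X) : BiHH B := ⟨X, F⟩

/-- The morphism of `biHH(B)` given by a `2`-morphism between `1`-endomorphisms. -/
def cell {X : B} {F G : X ⟶ X} (α : F ⟶ G) : of F ⟶ of G := Quot.mk _ (Expr.cell α)

/-- The isomorphism `(F, G) : F ≫ G ≅ G ≫ F` of `biHH(B)`. -/
def rot {X Y : B} (F : X ⟶ Y) (G : Y ⟶ X) : of (F ≫ G) ≅ of (G ≫ F) where
  hom := Quot.mk _ (Expr.rot F G)
  inv := Quot.mk _ (Expr.rotInv F G)
  hom_inv_id := Quot.sound (Rel.rot_rotInv F G)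
  inv_hom_id := Quot.sound (Rel.rotInv_rot F G)

@[simp]
theorem cell_id {X : B} (F : X ⟶ X) : cell (𝟙 F) = 𝟙 (of F) := Quot.sound (Rel.cell_id F)

theorem cell_comp {X : B} {F G H : X ⟶ X} (α : F ⟶ G) (β : G ⟶ H) :
    cell (α ≫ β) = cell α ≫ cell β := Quot.sound (Rel.cell_comp α β)

theorem cell_comp_assoc {X : B} {F G H : X ⟶ X} (α : F ⟶ G) (β : G ⟶ H) {z : BiHH B}
    (m : of H ⟶ z) : cell α ≫ cell β ≫ m = cell (α ≫ β) ≫ m := by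
  rw [cell_comp, Category.assoc]

/-- The isomorphism of `biHH(B)` given by an invertible `2`-morphism. -/
def cellIso {X : B} {F G : X ⟶ X} (α : F ≅ G) : of F ≅ of G where
  hom := cell α.hom
  inv := cell α.inv
  hom_inv_id := by rw [← cell_comp, α.hom_inv_id, cell_id]
  inv_hom_id := by rw [← cell_comp, α.inv_hom_id, cell_id]

theorem rot_naturality {X Y : B} {F F' : X ⟶ Y} {G G' : Y ⟶ X} (α : F ⟶ F') (β : G ⟶ G') :
    cell (α ▷ G ≫ F' ◁ β) ≫ (rot F' G').hom = (rot F G).hom ≫ cell (β ▷ F ≫ G' ◁ α) :=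
  Quot.sound (Rel.rot_naturality α β)

theorem rot_naturality_left {X Y : B} {F F' : X ⟶ Y} (α : F ⟶ F') (G : Y ⟶ X) :
    cell (α ▷ G) ≫ (rot F' G).hom = (rot F G).hom ≫ cell (G ◁ α) := by
  simpa using rot_naturality α (𝟙 G)

theorem rot_naturality_right {X Y : B} (F : X ⟶ Y) {G G' : Y ⟶ X} (β : G ⟶ G') :
    cell (F ◁ β) ≫ (rot F G').hom = (rot F G).hom ≫ cell (β ▷ F) := by
  simpa using rot_naturality (𝟙 F) β

theorem rot_comp {X Y Z : B} (F : X ⟶ Y) (G : Y ⟶ Z) (H : Z ⟶ X) :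
    (rot F (G ≫ H)).hom = cell (α_ F G H).inv ≫ (rot (F ≫ G) H).hom ≫ cell (α_ H F G).inv ≫
      (rot (H ≫ F) G).hom ≫ cell (α_ G H F).inv :=
  Quot.sound (Rel.rot_comp F G H)

theorem rot_id {X : B} (F : X ⟶ X) :
    (rot F (𝟙 X)).hom ≫ cell (λ_ F).hom = cell (ρ_ F).hom :=
  Quot.sound (Rel.rot_id F)

theorem rot_conj_left {X Y : B} {F F' : X ⟶ Y} (α : F ≅ F') (G : Y ⟶ X) :
    (rot F G).hom = cell (α.hom ▷ G) ≫ (rot F' G).hom ≫ cell (G ◁ α.inv) := by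
  rw [← Category.assoc, rot_naturality_left, Category.assoc, ← cell_comp, whiskerLeft_hom_inv,
    cell_id, Category.comp_id]

theorem rot_conj_right {X Y : B} (F : X ⟶ Y) {G G' : Y ⟶ X} (β : G ≅ G') :
    (rot F G).hom = cell (F ◁ β.hom) ≫ (rot F G').hom ≫ cell (β.inv ▷ F) := by
  rw [← Category.assoc, rot_naturality_right, Category.assoc, ← cell_comp, hom_inv_whiskerRight,
    cell_id, Category.comp_id]

end Presentation

section Lift

variable {B : Type u} [Bicategory.{w, v} B] {D : Type u'} [Category.{v'} D]

/-- The data of a functor `biHH(B) ⥤ D`, in terms of the presentation. -/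
structure LiftData (B : Type u) [Bicategory.{w, v} B] (D : Type u') [Category.{v'} D] where
  obj {X : B} (F : X ⟶ X) : D
  cell {X : B} {F G : X ⟶ X} (α : F ⟶ G) : obj F ⟶ obj G
  rot {X Y : B} (F : X ⟶ Y) (G : Y ⟶ X) : obj (F ≫ G) ≅ obj (G ≫ F)
  cell_id {X : B} (F : X ⟶ X) : cell (𝟙 F) = 𝟙 (obj F)
  cell_comp {X : B} {F G H : X ⟶ X} (α : F ⟶ G) (β : G ⟶ H) :
    cell (α ≫ β) = cell α ≫ cell β
  rot_naturality {X Y : B} {F F' : X ⟶ Y} {G G' : Y ⟶ X} (α : F ⟶ F') (β : G ⟶ G') :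
    cell (α ▷ G ≫ F' ◁ β) ≫ (rot F' G').hom = (rot F G).hom ≫ cell (β ▷ F ≫ G' ◁ α)
  rot_comp {X Y Z : B} (F : X ⟶ Y) (G : Y ⟶ Z) (H : Z ⟶ X) :
    (rot F (G ≫ H)).hom = cell (α_ F G H).inv ≫ (rot (F ≫ G) H).hom ≫ cell (α_ H F G).inv ≫
      (rot (H ≫ F) G).hom ≫ cell (α_ G H F).inv
  rot_id {X : B} (F : X ⟶ X) :
    (rot F (𝟙 X)).hom ≫ cell (λ_ F).hom = cell (ρ_ F).hom

namespace LiftData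

variable (S : LiftData B D)

/-- Evaluation of formal composites. -/
def eval : ∀ {x y : BiHH B}, Expr x y → (S.obj x.loop ⟶ S.obj y.loop)
  | _, _, .id _ => 𝟙 _
  | _, _, .comp a b => eval a ≫ eval b
  | _, _, .cell α => S.cell α
  | _, _, .rot F G => (S.rot F G).hom
  | _, _, .rotInv F G => (S.rot F G).inv

theorem eval_eq {x y : BiHH B} {a b : Expr x y} (h : Rel a b) : S.eval a = S.eval b := by
  induction h with
  | comp_left a _ ih => simp [eval, ih]
  | comp_right b _ ih => simp [eval, ih]
  | id_comp a => simp [eval]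
  | comp_id a => simp [eval]
  | assoc a b c => simp [eval]
  | cell_id F => exact S.cell_id F
  | cell_comp α β => exact S.cell_comp α β
  | rot_rotInv F G => simp [eval]
  | rotInv_rot F G => simp [eval]
  | rot_naturality α β => exact S.rot_naturality α β
  | rot_comp F G H => exact S.rot_comp F G H
  | rot_id F => exact S.rot_id F

/-- The functor out of `biHH(B)` determined by its values on the generators. -/
def functor : BiHH B ⥤ D where
  obj x := S.obj x.loop
  map := Quot.lift S.eval fun _ _ h => S.eval_eq h
  map_id _ := rfl
  map_comp := by
    rintro x y z ⟨a⟩ ⟨b⟩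
    rfl

@[simp]
theorem functor_obj {X : B} (F : X ⟶ X) : S.functor.obj (of F) = S.obj F := rfl

@[simp]
theorem functor_map_cell {X : B} {F G : X ⟶ X} (α : F ⟶ G) :
    S.functor.map (BiHH.cell α) = S.cell α := rfl

@[simp]
theorem functor_map_rot {X Y : B} (F : X ⟶ Y) (G : Y ⟶ X) :
    S.functor.map (BiHH.rot F G).hom = (S.rot F G).hom := rfl

@[simp]
theorem functor_map_rot_inv {X Y : B} (F : X ⟶ Y) (G : Y ⟶ X) :
    S.functor.map (BiHH.rot F G).inv = (S.rot F G).inv := rfl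

end LiftData

/-- A family of morphisms is natural on `biHH(B)` if it is natural on the generators. -/
theorem naturality_of_generators {P Q : BiHH B ⥤ D} (t : ∀ x, P.obj x ⟶ Q.obj x)
    (hc : ∀ {X : B} {F G : X ⟶ X} (α : F ⟶ G),
      P.map (cell α) ≫ t (of G) = t (of F) ≫ Q.map (cell α))
    (hr : ∀ {X Y : B} (F : X ⟶ Y) (G : Y ⟶ X),
      P.map (rot F G).hom ≫ t (of (G ≫ F)) = t (of (F ≫ G)) ≫ Q.map (rot F G).hom)
    {x y : BiHH B} (m : x ⟶ y) : P.map m ≫ t y = t x ≫ Q.map m := by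
  have key : ∀ {x y : BiHH B} (e : Expr x y),
      P.map (Quot.mk _ e : x ⟶ y) ≫ t y = t x ≫ Q.map (Quot.mk _ e : x ⟶ y) := by
    intro x y e
    induction e with
    | id x =>
        change P.map (𝟙 x) ≫ t x = t x ≫ Q.map (𝟙 x)
        simp
    | @comp x y z a b iha ihb =>
        change P.map ((Quot.mk _ a : x ⟶ y) ≫ (Quot.mk _ b : y ⟶ z)) ≫ t z =
          t x ≫ Q.map ((Quot.mk _ a : x ⟶ y) ≫ (Quot.mk _ b : y ⟶ z))
        rw [P.map_comp, Q.map_comp, Category.assoc, ihb, reassoc_of% iha]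
    | cell α => exact hc α
    | rot F G => exact hr F G
    | rotInv F G =>
        change P.map (rot F G).inv ≫ t _ = t _ ≫ Q.map (rot F G).inv
        rw [← cancel_epi (P.map (rot F G).hom), ← Category.assoc, ← P.map_comp,
          (rot F G).hom_inv_id, P.map_id, Category.id_comp, ← Category.assoc, hr, Category.assoc,
          ← Q.map_comp, (rot F G).hom_inv_id, Q.map_id, Category.comp_id]
  obtain ⟨e⟩ := m
  exact key e

end Lift

section Map

variable {B : Type u} [Bicategory.{w, v} B] {C : Type u'} [Bicategory.{w', v'} C]

/-- Functoriality of `biHH` on generators: a pseudofunctor sends `α` to its image and `(F, G)` to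
`(P F, P G)`, up to the coherence isomorphisms of the pseudofunctor. -/
def mapData (P : B ⥤ᵖ C) : LiftData B (BiHH C) where
  obj F := of (P.map F)
  cell α := cell (P.map₂ α)
  rot F G := cellIso (P.mapComp F G) ≪≫ rot (P.map F) (P.map G) ≪≫ cellIso (P.mapComp G F).symm
  cell_id F := by simp
  cell_comp α β := by simp [cell_comp]
  rot_naturality {X Y F F' G G'} α β := by
    simp only [cellIso, Iso.trans_hom, Category.assoc, Iso.symm_hom]
    rw [cell_comp_assoc]
    have h : P.map₂ (α ▷ G ≫ F' ◁ β) ≫ (P.mapComp F' G').hom =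
        (P.mapComp F G).hom ≫ (P.map₂ α ▷ P.map G ≫ P.map F' ◁ P.map₂ β) := by simp
    have h' : (P.mapComp G F).inv ≫ P.map₂ (β ▷ F ≫ G' ◁ α) =
        (P.map₂ β ▷ P.map F ≫ P.map G' ◁ P.map₂ α) ≫ (P.mapComp G' F').inv := by simp
    rw [h, ← cell_comp, h', cell_comp (P.mapComp F G).hom,
      cell_comp _ (P.mapComp G' F').inv, Category.assoc,
      ← Category.assoc (cell (P.map₂ α ▷ P.map G ≫ P.map F' ◁ P.map₂ β)), rot_naturality]
    simp only [Category.assoc]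
  rot_comp F G H := by
    simp only [cellIso, Iso.trans_hom, Category.assoc, Iso.symm_hom]
    rw [rot_conj_right (P.map F) (P.mapComp G H), rot_conj_left (P.mapComp F G) (P.map H),
      rot_conj_left (P.mapComp H F) (P.map G), rot_comp]
    simp only [Category.assoc, cell_comp_assoc, ← cell_comp]
    have e₁ : (P.mapComp F (G ≫ H)).hom ≫ P.map F ◁ (P.mapComp G H).hom ≫
        (α_ (P.map F) (P.map G) (P.map H)).inv =
        P.map₂ (α_ F G H).inv ≫ (P.mapComp (F ≫ G) H).hom ≫ (P.mapComp F G).hom ▷ P.map H := by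
      rw [P.mapComp_assoc_right_hom_assoc]
      simp
    have e₂ : (α_ (P.map H) (P.map F) (P.map G)).inv =
        P.map H ◁ (P.mapComp F G).inv ≫ (P.mapComp H (F ≫ G)).inv ≫ P.map₂ (α_ H F G).inv ≫
          (P.mapComp (H ≫ F) G).hom ≫ (P.mapComp H F).hom ▷ P.map G := by
      rw [P.mapComp_assoc_left_hom]
      simp only [P.map₂_inv_hom_assoc, Iso.inv_hom_id_assoc, whiskerLeft_inv_hom_assoc]
    have e₃ : (α_ (P.map G) (P.map H) (P.map F)).inv ≫ (P.mapComp G H).inv ▷ P.map F ≫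
        (P.mapComp (G ≫ H) F).inv = P.map G ◁ (P.mapComp H F).inv ≫
          (P.mapComp G (H ≫ F)).inv ≫ P.map₂ (α_ G H F).inv := by
      rw [P.mapComp_assoc_right_inv_assoc]
      simp [-Pseudofunctor.map₂_associator]
    rw [e₁, e₂, e₃]
  rot_id F := by
    simp only [cellIso, Iso.trans_hom, Category.assoc, Iso.symm_hom]
    rw [rot_conj_right (P.map F) (P.mapId _)]
    simp only [Category.assoc, cell_comp_assoc, ← cell_comp]
    have : (P.mapId _).inv ▷ P.map F ≫ (P.mapComp (𝟙 _) F).inv ≫ P.map₂ (λ_ F).hom =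
       (λ_ (P.map F)).hom := by simp
    rw [this, rot_id, ← cell_comp]
    simp

/-- Functoriality of `biHH` in pseudofunctors. -/
def map (P : B ⥤ᵖ C) : BiHH B ⥤ BiHH C := (mapData P).functor

end Map

section Transport

variable {B : Type u} [Bicategory.{w, v} B]

theorem slide_left {X Y : B} {F F' : X ⟶ Y} {G : Y ⟶ X} {K : X ⟶ X} {L : Y ⟶ Y}
    (x : K ⟶ F ≫ G) (α : F ⟶ F') (y : G ≫ F' ⟶ L) :
    cell (x ≫ α ▷ G) ≫ (rot F' G).hom ≫ cell y = cell x ≫ (rot F G).hom ≫ cell (G ◁ α ≫ y) := by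
  rw [cell_comp, cell_comp, Category.assoc, ← Category.assoc (cell (α ▷ G)), rot_naturality_left,
    Category.assoc]

theorem slide_left_assoc {X Y : B} {F F' : X ⟶ Y} {G : Y ⟶ X} {K : X ⟶ X} {L : Y ⟶ Y}
    (x : K ⟶ F ≫ G) (α : F ⟶ F') (y : G ≫ F' ⟶ L) {z : BiHH B} (m : of L ⟶ z) :
    cell x ≫ (rot F G).hom ≫ cell (G ◁ α ≫ y) ≫ m =
      cell (x ≫ α ▷ G) ≫ (rot F' G).hom ≫ cell y ≫ m := by
  have := congr_arg (· ≫ m) (slide_left x α y)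
  simpa only [Category.assoc] using this.symm

theorem slide_right {X Y : B} {F : X ⟶ Y} {G G' : Y ⟶ X} {K : X ⟶ X} {L : Y ⟶ Y}
    (x : K ⟶ F ≫ G) (β : G ⟶ G') (y : G' ≫ F ⟶ L) :
    cell (x ≫ F ◁ β) ≫ (rot F G').hom ≫ cell y = cell x ≫ (rot F G).hom ≫ cell (β ▷ F ≫ y) := by
  rw [cell_comp, cell_comp, Category.assoc, ← Category.assoc (cell (F ◁ β)), rot_naturality_right,
    Category.assoc]

theorem slide_ext {X Y : B} {F : X ⟶ Y} {G : Y ⟶ X} {K : X ⟶ X} {L : Y ⟶ Y}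
    {x x' : K ⟶ F ≫ G} {y y' : G ≫ F ⟶ L} (hx : x = x') (hy : y = y') :
    cell x ≫ (rot F G).hom ≫ cell y = cell x' ≫ (rot F G).hom ≫ cell y' := by
  rw [hx, hy]

theorem slide_comp {X Y Z : B} {F : X ⟶ Y} {G : Y ⟶ Z} {H : Z ⟶ X} {K : X ⟶ X} {L : Z ⟶ Y}
    {M : Y ⟶ Y} (x : K ⟶ (F ≫ G) ≫ H) (s : H ≫ F ⟶ L) (y : G ≫ L ⟶ M) :
    cell x ≫ (rot (F ≫ G) H).hom ≫ cell ((α_ H F G).inv ≫ s ▷ G) ≫ (rot L G).hom ≫ cell y =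
      cell (x ≫ (α_ F G H).hom) ≫ (rot F (G ≫ H)).hom ≫
        cell ((α_ G H F).hom ≫ G ◁ s ≫ y) := by
  rw [slide_left, rot_comp]
  simp only [Category.assoc, cell_comp_assoc, ← cell_comp]
  simp

/-- The morphism `F → F'` of `biHH(B)` induced by an adjunction `l ⊣ r` and a `2`-morphism
`φ : F ≫ l ⟶ l ≫ F'`: it is the composite
`F → F ≫ l ≫ r → l ≫ F' ≫ r ≅ r ≫ l ≫ F' → F'`. -/
def transport {X X' : B} {l : X ⟶ X'} {r : X' ⟶ X} (adj : Bicategory.Adjunction l r) {F : X ⟶ X}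
    {F' : X' ⟶ X'} (φ : F ≫ l ⟶ l ≫ F') : of F ⟶ of F' :=
  cell ((ρ_ F).inv ≫ F ◁ adj.unit ≫ (α_ F l r).inv ≫ φ ▷ r) ≫ (rot (l ≫ F') r).hom ≫
    cell ((α_ r l F').inv ≫ adj.counit ▷ F' ≫ (λ_ F').hom)

theorem transport_cell {X X' : B} {l : X ⟶ X'} {r : X' ⟶ X} (adj : Bicategory.Adjunction l r)
    {F G : X ⟶ X} {F' G' : X' ⟶ X'} (φ : F ≫ l ⟶ l ≫ F') (χ : G ≫ l ⟶ l ≫ G') (α : F ⟶ G)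
    (β : F' ⟶ G') (h : α ▷ l ≫ χ = φ ≫ l ◁ β) :
    cell α ≫ transport adj χ = transport adj φ ≫ cell β := by
  unfold transport
  have e₁ : α ≫ (ρ_ G).inv ≫ G ◁ adj.unit ≫ (α_ G l r).inv ≫ χ ▷ r =
      ((ρ_ F).inv ≫ F ◁ adj.unit ≫ (α_ F l r).inv ≫ φ ▷ r) ≫ (l ◁ β) ▷ r := by
    simp only [Category.assoc]
    rw [← comp_whiskerRight, ← h, comp_whiskerRight, rightUnitor_inv_naturality_assoc,
      ← whisker_exchange_assoc]
    simp
  have e₂ : ((α_ r l F').inv ≫ adj.counit ▷ F' ≫ (λ_ F').hom) ≫ β =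
      r ◁ l ◁ β ≫ (α_ r l G').inv ≫ adj.counit ▷ G' ≫ (λ_ G').hom := by
    simp only [Category.assoc]
    rw [← leftUnitor_naturality, ← whisker_exchange_assoc]
    simp
  rw [cell_comp_assoc, e₁, slide_left, ← e₂]
  simp only [Category.assoc, cell_comp]

theorem transport_id {X : B} (F : X ⟶ X) :
    transport (Bicategory.Adjunction.id X) ((ρ_ F).hom ≫ (λ_ F).inv) = 𝟙 (of F) := by
  unfold transport
  have h : (rot F (𝟙 X)).hom = cell ((ρ_ F).hom ≫ (λ_ F).inv) := by
    rw [cell_comp, ← rot_id, Category.assoc, ← cell_comp, Iso.hom_inv_id, cell_id,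
      Category.comp_id]
  rw [rot_conj_left (λ_ F) (𝟙 X), h]
  simp only [Category.assoc, ← cell_comp]
  rw [← cell_id]
  congr 1
  dsimp only [Bicategory.Adjunction.id]
  bicategory

theorem transport_comp {X X' X'' : B} {l₁ : X ⟶ X'} {r₁ : X' ⟶ X} {l₂ : X' ⟶ X''} {r₂ : X'' ⟶ X'}
    (adj₁ : Bicategory.Adjunction l₁ r₁) (adj₂ : Bicategory.Adjunction l₂ r₂) {F : X ⟶ X}
    {F' : X' ⟶ X'} {F'' : X'' ⟶ X''} (φ : F ≫ l₁ ⟶ l₁ ≫ F') (χ : F' ≫ l₂ ⟶ l₂ ≫ F'') :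
    transport (adj₁.comp adj₂) ((α_ F l₁ l₂).inv ≫ φ ▷ l₂ ≫ (α_ l₁ F' l₂).hom ≫ l₁ ◁ χ ≫
      (α_ l₁ l₂ F'').inv) = transport adj₁ φ ≫ transport adj₂ χ := by
  unfold transport
  set ηχ : F' ⟶ (l₂ ≫ F'') ≫ r₂ := (ρ_ F').inv ≫ F' ◁ adj₂.unit ≫ (α_ F' l₂ r₂).inv ≫ χ ▷ r₂
    with hηχ
  have e₁ : ((α_ r₁ l₁ F').inv ≫ adj₁.counit ▷ F' ≫ (λ_ F').hom) ≫ ηχ =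
      (r₁ ◁ (l₁ ◁ ηχ ≫ (α_ l₁ (l₂ ≫ F'') r₂).inv)) ≫ (α_ r₁ (l₁ ≫ l₂ ≫ F'') r₂).inv ≫
        ((α_ r₁ l₁ (l₂ ≫ F'')).inv ≫ adj₁.counit ▷ (l₂ ≫ F'') ≫ (λ_ _).hom) ▷ r₂ := by
    simp only [Category.assoc]
    rw [← leftUnitor_naturality, ← whisker_exchange_assoc]
    bicategory
  rw [Category.assoc, Category.assoc, cell_comp_assoc, e₁, slide_left_assoc, slide_comp,
    rot_conj_left (α_ l₁ l₂ F'') (r₂ ≫ r₁)]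
  rw [Category.assoc, Category.assoc, cell_comp_assoc, ← cell_comp]
  refine slide_ext ?_ ?_
  · dsimp only [Bicategory.Adjunction.comp, Bicategory.Adjunction.compUnit]
    rw [hηχ]
    calc
      _ = 𝟙 _ ⊗≫ F ◁ adj₁.unit ⊗≫ ((F ≫ l₁) ◁ adj₂.unit ≫ φ ▷ (l₂ ≫ r₂)) ▷ r₁ ⊗≫
          l₁ ◁ χ ▷ (r₂ ≫ r₁) ⊗≫ 𝟙 _ := by bicategory
      _ = 𝟙 _ ⊗≫ F ◁ adj₁.unit ⊗≫ (φ ▷ 𝟙 _ ≫ (l₁ ≫ F') ◁ adj₂.unit) ▷ r₁ ⊗≫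
          l₁ ◁ χ ▷ (r₂ ≫ r₁) ⊗≫ 𝟙 _ := by rw [whisker_exchange]
      _ = _ := by bicategory
  · dsimp only [Bicategory.Adjunction.comp, Bicategory.Adjunction.compCounit]
    bicategory

theorem transport_rot {X X' Y Y' : B} {l₁ : X ⟶ X'} {r₁ : X' ⟶ X} {l₂ : Y ⟶ Y'} {r₂ : Y' ⟶ Y}
    (adj₁ : Bicategory.Adjunction l₁ r₁) (adj₂ : Bicategory.Adjunction l₂ r₂) {F : X ⟶ Y}
    {G : Y ⟶ X} {F' : X' ⟶ Y'} {G' : Y' ⟶ X'} (φ : F ≫ l₂ ⟶ l₁ ≫ F') (χ : G ≫ l₁ ⟶ l₂ ≫ G') :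
    transport adj₁ ((α_ F G l₁).hom ≫ F ◁ χ ≫ (α_ F l₂ G').inv ≫ φ ▷ G' ≫ (α_ l₁ F' G').hom) ≫
        (rot F' G').hom =
      (rot F G).hom ≫ transport adj₂
        ((α_ G F l₂).hom ≫ G ◁ φ ≫ (α_ G l₁ F').inv ≫ χ ▷ F' ≫ (α_ l₂ G' F').hom) := by
  -- the mates of `φ` and `χ`, and the part of the counit that is used on both sides
  let k : F ⟶ (l₁ ≫ F') ≫ r₂ := (ρ_ F).inv ≫ F ◁ adj₂.unit ≫ (α_ F l₂ r₂).inv ≫ φ ▷ r₂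
  let j : G ⟶ (l₂ ≫ G') ≫ r₁ := (ρ_ G).inv ≫ G ◁ adj₁.unit ≫ (α_ G l₁ r₁).inv ≫ χ ▷ r₁
  let e : r₁ ≫ l₁ ≫ F' ⟶ F' := (α_ r₁ l₁ F').inv ≫ adj₁.counit ▷ F' ≫ (λ_ F').hom
  let ψ : r₂ ≫ G ⟶ G' ≫ r₁ := r₂ ◁ j ≫ (α_ r₂ (l₂ ≫ G') r₁).inv ≫
    ((α_ r₂ l₂ G').inv ≫ adj₂.counit ▷ G' ≫ (λ_ G').hom) ▷ r₁
  let s : G ≫ l₁ ≫ F' ⟶ l₂ ≫ G' ≫ F' := (α_ G l₁ F').inv ≫ χ ▷ F' ≫ (α_ l₂ G' F').hom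
  let t : r₂ ≫ l₂ ≫ G' ≫ F' ⟶ G' ≫ F' :=
    (α_ r₂ l₂ (G' ≫ F')).inv ≫ adj₂.counit ▷ (G' ≫ F') ≫ (λ_ (G' ≫ F')).hom
  have left : transport adj₁
        ((α_ F G l₁).hom ≫ F ◁ χ ≫ (α_ F l₂ G').inv ≫ φ ▷ G' ≫ (α_ l₁ F' G').hom) ≫
        (rot F' G').hom =
      cell (k ▷ G ≫ (α_ (l₁ ≫ F') r₂ G).hom ≫ (l₁ ≫ F') ◁ ψ) ≫ (rot (l₁ ≫ F') (G' ≫ r₁)).hom ≫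
        cell ((α_ G' r₁ (l₁ ≫ F')).hom ≫ G' ◁ e) := by
    unfold transport
    have h₁ : cell ((α_ r₁ l₁ (F' ≫ G')).inv ≫ adj₁.counit ▷ (F' ≫ G') ≫ (λ_ (F' ≫ G')).hom) ≫
        (rot F' G').hom = cell (r₁ ◁ (α_ l₁ F' G').inv ≫ (α_ r₁ (l₁ ≫ F') G').inv ≫ e ▷ G') ≫
          (rot F' G').hom ≫ cell (𝟙 _) := by
      rw [cell_id, Category.comp_id]
      congr 2
      bicategory
    rw [Category.assoc, Category.assoc, h₁, slide_left_assoc, slide_comp]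
    refine slide_ext ?_ (by simp)
    symm
    calc
      _ = 𝟙 _ ⊗≫ (k ▷ G ≫ ((l₁ ≫ F') ≫ r₂) ◁ j) ⊗≫ (l₁ ≫ F') ◁ adj₂.counit ▷ (G' ≫ r₁) ⊗≫ 𝟙 _ := by
        simp only [ψ]
        bicategory
      _ = 𝟙 _ ⊗≫ (F ◁ j ≫ k ▷ ((l₂ ≫ G') ≫ r₁)) ⊗≫ (l₁ ≫ F') ◁ adj₂.counit ▷ (G' ≫ r₁) ⊗≫
          𝟙 _ := by rw [whisker_exchange]
      _ = 𝟙 _ ⊗≫ F ◁ j ⊗≫ F ◁ adj₂.unit ▷ (l₂ ≫ G' ≫ r₁) ⊗≫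
          (φ ▷ (r₂ ≫ l₂) ≫ (l₁ ≫ F') ◁ adj₂.counit) ▷ (G' ≫ r₁) ⊗≫ 𝟙 _ := by
        simp only [k]
        bicategory
      _ = 𝟙 _ ⊗≫ F ◁ j ⊗≫ F ◁ leftZigzag adj₂.unit adj₂.counit ▷ (G' ≫ r₁) ⊗≫
          φ ▷ (G' ≫ r₁) ⊗≫ 𝟙 _ := by
        rw [← whisker_exchange, leftZigzag]
        bicategory
      _ = _ := by
        rw [adj₂.left_triangle]
        simp only [j]
        bicategory
  have right : (rot F G).hom ≫ transport adj₂
        ((α_ G F l₂).hom ≫ G ◁ φ ≫ (α_ G l₁ F').inv ≫ χ ▷ F' ≫ (α_ l₂ G' F').hom) =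
      cell (k ▷ G ≫ (α_ (l₁ ≫ F') r₂ G).hom) ≫ (rot (l₁ ≫ F') (r₂ ≫ G)).hom ≫
        cell ((α_ r₂ G (l₁ ≫ F')).hom ≫ r₂ ◁ s ≫ t) := by
    unfold transport
    have h₁ : (ρ_ (G ≫ F)).inv ≫ (G ≫ F) ◁ adj₂.unit ≫ (α_ (G ≫ F) l₂ r₂).inv ≫
        ((α_ G F l₂).hom ≫ G ◁ φ ≫ (α_ G l₁ F').inv ≫ χ ▷ F' ≫ (α_ l₂ G' F').hom) ▷ r₂ =
        G ◁ k ≫ (α_ G (l₁ ≫ F') r₂).inv ≫ s ▷ r₂ := by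
      simp only [k, s]
      bicategory
    rw [h₁, cell_comp, Category.assoc, ← Category.assoc, ← rot_naturality_left, Category.assoc,
      slide_comp]
  rw [left, right, ← Category.assoc (k ▷ G), slide_right]
  refine slide_ext rfl ?_
  let ω : r₂ ≫ G ≫ l₁ ⟶ G' := r₂ ◁ χ ≫ (α_ r₂ l₂ G').inv ≫ adj₂.counit ▷ G' ≫ (λ_ G').hom
  calc
    _ = 𝟙 _ ⊗≫ (r₂ ≫ G) ◁ adj₁.unit ▷ (l₁ ≫ F') ⊗≫
        (ω ▷ (r₁ ≫ l₁) ≫ G' ◁ adj₁.counit) ▷ F' ⊗≫ 𝟙 _ := by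
      simp only [ψ, e, j, ω]
      bicategory
    _ = 𝟙 _ ⊗≫ (r₂ ≫ G) ◁ leftZigzag adj₁.unit adj₁.counit ▷ F' ⊗≫ ω ▷ F' ⊗≫ 𝟙 _ := by
      rw [← whisker_exchange, leftZigzag]
      bicategory
    _ = _ := by
      rw [adj₁.left_triangle]
      simp only [ω, s, t]
      bicategory

theorem transport_congr {X X' : B} {l m : X ⟶ X'} {r s' : X' ⟶ X} (adj : Bicategory.Adjunction l r)
    (adj' : Bicategory.Adjunction m s') {F : X ⟶ X} {F' : X' ⟶ X'} (φ : F ≫ l ⟶ l ≫ F')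
    (χ : F ≫ m ⟶ m ≫ F') (γ : l ≅ m) (h : F ◁ γ.hom ≫ χ = φ ≫ γ.hom ▷ F') :
    transport adj φ = transport adj' χ := by
  -- the mate of the inverse of `γ`
  let δ : r ⟶ s' := (ρ_ r).inv ≫ r ◁ adj'.unit ≫ r ◁ γ.inv ▷ s' ≫ (α_ r l s').inv ≫
    adj.counit ▷ s' ≫ (λ_ s').hom
  have h₁ : (ρ_ F).inv ≫ F ◁ adj'.unit ≫ (α_ F m s').inv ≫ χ ▷ s' =
      (((ρ_ F).inv ≫ F ◁ adj.unit ≫ (α_ F l r).inv ≫ φ ▷ r) ≫ (γ.hom ▷ F') ▷ r) ≫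
        (m ≫ F') ◁ δ := by
    have h₀ : adj.unit ≫ γ.hom ▷ r ≫ m ◁ δ = adj'.unit := by
      calc
        _ = adj.unit ⊗≫ (γ.hom ▷ (r ≫ 𝟙 X) ≫ m ◁ (r ◁ adj'.unit)) ⊗≫
            m ◁ r ◁ γ.inv ▷ s' ⊗≫ m ◁ adj.counit ▷ s' ⊗≫ 𝟙 _ := by
          simp only [δ]
          bicategory
        _ = 𝟙 _ ⊗≫ (adj.unit ▷ 𝟙 X ≫ (l ≫ r) ◁ adj'.unit) ⊗≫
            (γ.hom ▷ (r ≫ m) ≫ m ◁ r ◁ γ.inv) ▷ s' ⊗≫ m ◁ adj.counit ▷ s' ⊗≫ 𝟙 _ := by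
          rw [← whisker_exchange]
          bicategory
        _ = 𝟙 _ ⊗≫ adj'.unit ⊗≫ (adj.unit ▷ m ≫ (l ≫ r) ◁ γ.inv) ▷ s' ⊗≫
            (γ.hom ▷ (r ≫ l) ≫ m ◁ adj.counit) ▷ s' ⊗≫ 𝟙 _ := by
          rw [← whisker_exchange, ← whisker_exchange]
          bicategory
        _ = 𝟙 _ ⊗≫ adj'.unit ⊗≫ γ.inv ▷ s' ⊗≫ leftZigzag adj.unit adj.counit ▷ s' ⊗≫
            γ.hom ▷ s' ⊗≫ 𝟙 _ := by
          rw [← whisker_exchange, ← whisker_exchange, leftZigzag]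
          bicategory
        _ = 𝟙 _ ⊗≫ adj'.unit ≫ (γ.inv ≫ γ.hom) ▷ s' ⊗≫ 𝟙 _ := by
          rw [adj.left_triangle]
          bicategory
        _ = _ := by
          rw [γ.inv_hom_id]
          bicategory
    symm
    calc
      _ = 𝟙 _ ⊗≫ F ◁ adj.unit ⊗≫ (φ ≫ γ.hom ▷ F') ▷ r ⊗≫ (m ≫ F') ◁ δ := by bicategory
      _ = 𝟙 _ ⊗≫ F ◁ (adj.unit ≫ γ.hom ▷ r) ⊗≫ (χ ▷ r ≫ (m ≫ F') ◁ δ) := by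
        rw [← h]
        bicategory
      _ = 𝟙 _ ⊗≫ F ◁ (adj.unit ≫ γ.hom ▷ r ≫ m ◁ δ) ⊗≫ χ ▷ s' := by
        rw [← whisker_exchange]
        bicategory
      _ = _ := by
        rw [h₀]
        bicategory
  have h₂ : (r ◁ γ.hom ▷ F') ≫ δ ▷ (m ≫ F') ≫ (α_ s' m F').inv ≫ adj'.counit ▷ F' ≫ (λ_ F').hom =
      (α_ r l F').inv ≫ adj.counit ▷ F' ≫ (λ_ F').hom := by
    have h₀ : r ◁ γ.hom ≫ δ ▷ m ≫ adj'.counit = adj.counit := by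
      calc
        _ = 𝟙 _ ⊗≫ r ◁ γ.hom ⊗≫ r ◁ adj'.unit ▷ m ⊗≫ r ◁ γ.inv ▷ (s' ≫ m) ⊗≫
            (adj.counit ▷ (s' ≫ m) ≫ 𝟙 _ ◁ adj'.counit) ⊗≫ 𝟙 _ := by
          simp only [δ]
          bicategory
        _ = 𝟙 _ ⊗≫ r ◁ γ.hom ⊗≫ r ◁ adj'.unit ▷ m ⊗≫ r ◁ (γ.inv ▷ (s' ≫ m) ≫
            l ◁ adj'.counit) ⊗≫ adj.counit ⊗≫ 𝟙 _ := by
          rw [← whisker_exchange]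
          bicategory
        _ = 𝟙 _ ⊗≫ r ◁ γ.hom ⊗≫ r ◁ leftZigzag adj'.unit adj'.counit ⊗≫ r ◁ γ.inv ⊗≫
            adj.counit ⊗≫ 𝟙 _ := by
          rw [← whisker_exchange, leftZigzag]
          bicategory
        _ = 𝟙 _ ⊗≫ r ◁ (γ.hom ≫ γ.inv) ⊗≫ adj.counit ⊗≫ 𝟙 _ := by
          rw [adj'.left_triangle]
          bicategory
        _ = _ := by
          rw [γ.hom_inv_id]
          bicategory
    rw [← h₀]
    bicategory
  unfold transport
  rw [h₁, slide_right, slide_left, h₂]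

end Transport


section Functoriality

theorem paste_squares {D : Type u} [Category.{v} D] {a a' b b' x x' y y' : D} (j : b ≅ y)
    (j' : b' ≅ y') {i : a ⟶ x} {i' : a' ⟶ x'} {r : x ⟶ y} {r' : x' ⟶ y'} {t₁ : a ⟶ a'}
    {t₂ : b ⟶ b'} {s₁ : x ⟶ x'} {s₂ : y ⟶ y'} (h₁ : i ≫ s₁ = t₁ ≫ i')
    (h₂ : j.hom ≫ s₂ = t₂ ≫ j'.hom) (h₃ : s₁ ≫ r' = r ≫ s₂) :
    (i ≫ r ≫ j.inv) ≫ t₂ = t₁ ≫ i' ≫ r' ≫ j'.inv := by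
  rw [← cancel_mono j'.hom]
  simp only [Category.assoc, Iso.inv_hom_id, Category.comp_id, ← h₂, Iso.inv_hom_id_assoc]
  rw [← h₃, reassoc_of% h₁]

open Oplax
open scoped Oplax.OplaxTrans

variable {A : Type u} [Bicategory.{w, v} A] {B : Type u'} [Bicategory.{w', v'} B]

/-- The natural transformation `biHH(P) ⟶ biHH(P')` induced by an oplax natural transformation
`σ : P ⟶ P'` all of whose components are left adjoints. -/
noncomputable def mapTrans {P P' : A ⥤ᵖ B} (σ : P.toOplax ⟶ P'.toOplax)
    (adj : ∀ a, Bicategory.IsLeftAdjoint (σ.app a)) : map P ⟶ map P' where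
  app x := transport (@Bicategory.Adjunction.ofIsLeftAdjoint _ _ _ _ (σ.app x.pt) (adj x.pt))
    (σ.naturality x.loop)
  naturality _ _ m := by
    refine naturality_of_generators (P := map P) (Q := map P') (fun x => transport
      (@Bicategory.Adjunction.ofIsLeftAdjoint _ _ _ _ (σ.app x.pt) (adj x.pt))
      (σ.naturality x.loop)) ?_ ?_ m
    · intro X F G α
      exact transport_cell _ _ _ (P.map₂ α) (P'.map₂ α) (σ.naturality_naturality α)
    · intro X Y F G
      have h₁ := transport_cell
        (@Bicategory.Adjunction.ofIsLeftAdjoint _ _ _ _ (σ.app X) (adj X))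
        (σ.naturality (F ≫ G)) ((α_ _ _ _).hom ≫ P.map F ◁ σ.naturality G ≫
          (α_ _ _ _).inv ≫ σ.naturality F ▷ P'.map G ≫ (α_ _ _ _).hom)
        (P.mapComp F G).hom (P'.mapComp F G).hom (σ.naturality_comp F G).symm
      have h₂ := transport_cell
        (@Bicategory.Adjunction.ofIsLeftAdjoint _ _ _ _ (σ.app Y) (adj Y))
        (σ.naturality (G ≫ F)) ((α_ _ _ _).hom ≫ P.map G ◁ σ.naturality F ≫
          (α_ _ _ _).inv ≫ σ.naturality G ▷ P'.map F ≫ (α_ _ _ _).hom)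
        (P.mapComp G F).hom (P'.mapComp G F).hom (σ.naturality_comp G F).symm
      have h₃ := transport_rot
        (@Bicategory.Adjunction.ofIsLeftAdjoint _ _ _ _ (σ.app X) (adj X))
        (@Bicategory.Adjunction.ofIsLeftAdjoint _ _ _ _ (σ.app Y) (adj Y))
        (σ.naturality F) (σ.naturality G)
      exact paste_squares (cellIso (P.mapComp G F)) (cellIso (P'.mapComp G F)) h₁ h₂ h₃

theorem transport_adj {X X' : B} {l : X ⟶ X'} {r s : X' ⟶ X} (adj : Bicategory.Adjunction l r)
    (adj' : Bicategory.Adjunction l s) {F : X ⟶ X} {F' : X' ⟶ X'} (φ : F ≫ l ⟶ l ≫ F') :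
    transport adj φ = transport adj' φ :=
  transport_congr adj adj' φ φ (Iso.refl l) (by simp)

theorem mapTrans_congr {P P' : A ⥤ᵖ B} {σ τ : P.toOplax ⟶ P'.toOplax} (e : σ ≅ τ)
    (hσ : ∀ a, Bicategory.IsLeftAdjoint (σ.app a)) (hτ : ∀ a, Bicategory.IsLeftAdjoint (τ.app a)) :
    mapTrans σ hσ = mapTrans τ hτ := by
  ext x
  refine transport_congr _ _ _ _ ⟨e.hom.as.app x.pt, e.inv.as.app x.pt, ?_, ?_⟩
    (e.hom.as.naturality x.loop)
  · exact congr_arg (fun m => m.as.app x.pt) e.hom_inv_id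
  · exact congr_arg (fun m => m.as.app x.pt) e.inv_hom_id

theorem mapTrans_id (P : A ⥤ᵖ B)
    (h : ∀ a, Bicategory.IsLeftAdjoint ((𝟙 P.toOplax : P.toOplax ⟶ P.toOplax).app a)) :
    mapTrans (𝟙 P.toOplax) h = 𝟙 (map P) := by
  ext x
  exact (transport_adj _ (Bicategory.Adjunction.id _) _).trans (transport_id _)

theorem mapTrans_comp {P P' Q : A ⥤ᵖ B} (σ : P.toOplax ⟶ P'.toOplax)
    (τ : P'.toOplax ⟶ Q.toOplax)
    (hσ : ∀ a, Bicategory.IsLeftAdjoint (σ.app a)) (hτ : ∀ a, Bicategory.IsLeftAdjoint (τ.app a))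
    (h : ∀ a, Bicategory.IsLeftAdjoint ((σ ≫ τ).app a)) :
    mapTrans (σ ≫ τ) h = mapTrans σ hσ ≫ mapTrans τ hτ := by
  ext x
  exact (transport_adj _ (Bicategory.Adjunction.comp _ _) _).trans (transport_comp _ _ _ _)

end Functoriality

end BiHH

/-- The category `Fun(A, B)`. Its objects are the pseudofunctors `A ⥤ᵖ B`; its morphisms are the
isomorphism classes of oplax natural transformations all of whose components are left adjoints
(for instance, of pseudonatural equivalences, or of transformations with identity components). -/
structure PseudoFun (A : Type u) [Bicategory.{w, v} A] (B : Type u') [Bicategory.{w', v'} B] where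
  /-- The underlying pseudofunctor. -/
  toPseudofunctor : A ⥤ᵖ B

namespace PseudoFun

open Oplax
open scoped Oplax.OplaxTrans Oplax.OplaxTrans.OplaxFunctor

variable {A : Type u} [Bicategory.{w, v} A] {B : Type u'} [Bicategory.{w', v'} B]

/-- Representatives of the morphisms of `Fun(A, B)`: oplax natural transformations whose
components are left adjoints. -/
structure Trans (P P' : PseudoFun A B) where
  /-- The underlying natural transformation. -/
  trans : P.toPseudofunctor.toOplax ⟶ P'.toPseudofunctor.toOplax
  isLeftAdjoint (a : A) : Bicategory.IsLeftAdjoint (trans.app a)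

/-- Two transformations are identified if there is an invertible modification between them. -/
instance transSetoid (P P' : PseudoFun A B) : Setoid (Trans P P') where
  r σ τ := Nonempty (σ.trans ≅ τ.trans)
  iseqv := ⟨fun _ => ⟨Iso.refl _⟩, fun ⟨e⟩ => ⟨e.symm⟩, fun ⟨e⟩ ⟨e'⟩ => ⟨e ≪≫ e'⟩⟩

/-- The identity transformation. -/
def Trans.id (P : PseudoFun A B) : Trans P P where
  trans := 𝟙 _
  isLeftAdjoint _ := Bicategory.IsLeftAdjoint.mk (Bicategory.Adjunction.id _)

/-- The composite of two transformations. -/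
def Trans.comp {P P' Q : PseudoFun A B} (σ : Trans P P') (τ : Trans P' Q) : Trans P Q where
  trans := σ.trans ≫ τ.trans
  isLeftAdjoint a := by
    have := σ.isLeftAdjoint a
    have := τ.isLeftAdjoint a
    exact Bicategory.IsLeftAdjoint.mk ((Bicategory.Adjunction.ofIsLeftAdjoint (σ.trans.app a)).comp
      (Bicategory.Adjunction.ofIsLeftAdjoint (τ.trans.app a)))

instance : Category (PseudoFun A B) where
  Hom P P' := Quotient (transSetoid P P')
  id P := Quotient.mk _ (Trans.id P)
  comp := Quotient.map₂ Trans.comp (by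
    rintro σ σ' ⟨e⟩ τ τ' ⟨e'⟩
    have h : σ.trans ≫ τ.trans ≅ σ'.trans ≫ τ'.trans :=
      whiskerRightIso e τ.trans ≪≫ whiskerLeftIso σ'.trans e'
    exact ⟨h⟩)
  id_comp := by
    rintro P P' ⟨σ⟩
    exact Quotient.sound ⟨λ_ σ.trans⟩
  comp_id := by
    rintro P P' ⟨σ⟩
    exact Quotient.sound ⟨ρ_ σ.trans⟩
  assoc := by
    rintro P P' Q Q' ⟨σ⟩ ⟨τ⟩ ⟨υ⟩
    exact Quotient.sound ⟨α_ σ.trans τ.trans υ.trans⟩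

end PseudoFun


namespace AdjEnd

/-- The two objects of `AdjEnd`. -/
inductive Vertex : Type
  | zero
  | one

/-- The generating `1`-morphisms of `AdjEnd`: the left adjoint `f : 0 → 1`, the right adjoint
`g : 1 → 0` and the free endomorphism `q : 0 → 0`. -/
inductive Edge : Vertex → Vertex → Type
  | f : Edge .zero .one
  | g : Edge .one .zero
  | q : Edge .zero .zero

instance : Quiver Vertex := ⟨Edge⟩

/-- The `1`-morphisms of `AdjEnd`: words in `f`, `g`, `q`, written in diagrammatic order. -/
abbrev Word (a b : Vertex) : Type := Quiver.Path a b

/-- The one-letter word of a generator. -/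
abbrev letter {a b : Vertex} (e : Edge a b) : Word a b := Quiver.Hom.toPath (V := Vertex) e

/-- Formal composites of the generating `2`-morphisms: the unit `u : 1 → g ∘ f` and the counit
`c : f ∘ g → 1`. The constructor `ofEq` gives the identities. -/
inductive Cell : ∀ {a b : Vertex}, Word a b → Word a b → Type
  | ofEq {a b : Vertex} {p r : Word a b} (h : p = r) : Cell p r
  | vcomp {a b : Vertex} {p r s : Word a b} (η : Cell p r) (θ : Cell r s) : Cell p s
  | whiskerLeft {a b c : Vertex} (p : Word a b) {r s : Word b c} (η : Cell r s) :
      Cell (p.comp r) (p.comp s)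
  | whiskerRight {a b c : Vertex} {r s : Word a b} (η : Cell r s) (p : Word b c) :
      Cell (r.comp p) (s.comp p)
  | unit : Cell (Quiver.Path.nil : Word .zero .zero) ((letter .f).comp (letter .g))
  | counit : Cell ((letter .g).comp (letter .f)) (Quiver.Path.nil : Word .one .one)

/-- The relations between formal composites: the laws of a strict `2`-category and the two
triangle identities. -/
inductive Rel : ∀ {a b : Vertex} {p r : Word a b}, Cell p r → Cell p r → Prop
  | vcomp_left {a b : Vertex} {p r s : Word a b} (η : Cell p r) {θ θ' : Cell r s} :
      Rel θ θ' → Rel (η.vcomp θ) (η.vcomp θ')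
  | vcomp_right {a b : Vertex} {p r s : Word a b} {η η' : Cell p r} (θ : Cell r s) :
      Rel η η' → Rel (η.vcomp θ) (η'.vcomp θ)
  | whisker_left {a b c : Vertex} (p : Word a b) {r s : Word b c} {η η' : Cell r s} :
      Rel η η' → Rel (η.whiskerLeft p) (η'.whiskerLeft p)
  | whisker_right {a b c : Vertex} {r s : Word a b} {η η' : Cell r s} (p : Word b c) :
      Rel η η' → Rel (η.whiskerRight p) (η'.whiskerRight p)
  | id_vcomp {a b : Vertex} {p r : Word a b} (η : Cell p r) :
      Rel ((Cell.ofEq rfl).vcomp η) η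
  | vcomp_id {a b : Vertex} {p r : Word a b} (η : Cell p r) :
      Rel (η.vcomp (Cell.ofEq rfl)) η
  | assoc {a b : Vertex} {p r s t : Word a b} (η : Cell p r) (θ : Cell r s) (ι : Cell s t) :
      Rel ((η.vcomp θ).vcomp ι) (η.vcomp (θ.vcomp ι))
  | whiskerLeft_id {a b c : Vertex} (p : Word a b) (r : Word b c) :
      Rel ((Cell.ofEq (rfl : r = r)).whiskerLeft p) (Cell.ofEq rfl)
  | whiskerLeft_comp {a b c : Vertex} (p : Word a b) {r s t : Word b c} (η : Cell r s)
      (θ : Cell s t) :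
      Rel ((η.vcomp θ).whiskerLeft p) ((η.whiskerLeft p).vcomp (θ.whiskerLeft p))
  | id_whiskerLeft {a b : Vertex} {p r : Word a b} (η : Cell p r) :
      Rel (η.whiskerLeft Quiver.Path.nil) (((Cell.ofEq (Quiver.Path.nil_comp p)).vcomp η).vcomp
        (Cell.ofEq (Quiver.Path.nil_comp r).symm))
  | comp_whiskerLeft {a b c d : Vertex} (p : Word a b) (r : Word b c) {s t : Word c d}
      (η : Cell s t) :
      Rel (η.whiskerLeft (p.comp r)) (((Cell.ofEq (Quiver.Path.comp_assoc p r s)).vcomp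
        ((η.whiskerLeft r).whiskerLeft p)).vcomp
          (Cell.ofEq (Quiver.Path.comp_assoc p r t).symm))
  | id_whiskerRight {a b c : Vertex} (p : Word a b) (r : Word b c) :
      Rel ((Cell.ofEq (rfl : p = p)).whiskerRight r) (Cell.ofEq rfl)
  | comp_whiskerRight {a b c : Vertex} {p r s : Word a b} (η : Cell p r) (θ : Cell r s)
      (t : Word b c) :
      Rel ((η.vcomp θ).whiskerRight t) ((η.whiskerRight t).vcomp (θ.whiskerRight t))
  | whiskerRight_id {a b : Vertex} {p r : Word a b} (η : Cell p r) :
      Rel (η.whiskerRight Quiver.Path.nil) (((Cell.ofEq (Quiver.Path.comp_nil p)).vcomp η).vcomp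
        (Cell.ofEq (Quiver.Path.comp_nil r).symm))
  | whiskerRight_comp {a b c d : Vertex} {p r : Word a b} (η : Cell p r) (s : Word b c)
      (t : Word c d) :
      Rel (η.whiskerRight (s.comp t)) (((Cell.ofEq (Quiver.Path.comp_assoc p s t).symm).vcomp
        ((η.whiskerRight s).whiskerRight t)).vcomp
          (Cell.ofEq (Quiver.Path.comp_assoc r s t)))
  | whisker_assoc {a b c d : Vertex} (p : Word a b) {r s : Word b c} (η : Cell r s)
      (t : Word c d) :
      Rel ((η.whiskerLeft p).whiskerRight t) (((Cell.ofEq (Quiver.Path.comp_assoc p r t)).vcomp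
        ((η.whiskerRight t).whiskerLeft p)).vcomp
          (Cell.ofEq (Quiver.Path.comp_assoc p s t).symm))
  | whisker_exchange {a b c : Vertex} {p r : Word a b} {s t : Word b c} (η : Cell p r)
      (θ : Cell s t) :
      Rel ((θ.whiskerLeft p).vcomp (η.whiskerRight t))
        ((η.whiskerRight s).vcomp (θ.whiskerLeft r))
  | left_triangle :
      Rel (((Cell.unit.whiskerRight (letter .f)).vcomp
        (Cell.ofEq (Quiver.Path.comp_assoc (letter .f) (letter .g) (letter .f)))).vcomp
          (Cell.counit.whiskerLeft (letter .f))) (Cell.ofEq (Quiver.Path.nil_comp (letter .f)))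
  | right_triangle :
      Rel (((Cell.unit.whiskerLeft (letter .g)).vcomp
        (Cell.ofEq (Quiver.Path.comp_assoc (letter .g) (letter .f) (letter .g)).symm)).vcomp
          (Cell.counit.whiskerRight (letter .g)))
        (Cell.ofEq (Quiver.Path.nil_comp (letter .g)).symm)

end AdjEnd

/-- The free `2`-category `AdjEnd` on an adjunction `f ⊣ g` between two objects `0` and `1`
together with an endomorphism `q` of the object `0`. -/
def AdjEnd : Type := AdjEnd.Vertex

namespace AdjEnd

/-- The object `0`. -/
def zero : AdjEnd := Vertex.zero

/-- The object `1`. -/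
def one : AdjEnd := Vertex.one

instance : CategoryStruct AdjEnd where
  Hom a b := Word a b
  id _ := Quiver.Path.nil
  comp p r := Quiver.Path.comp p r

/-- The `2`-morphisms of `AdjEnd`. -/
instance homCategory (a b : AdjEnd) : Category.{0} (a ⟶ b) where
  Hom p r := Quot (@Rel a b p r)
  id _ := Quot.mk _ (Cell.ofEq rfl)
  comp := Quot.map₂ Cell.vcomp (fun a _ _ => Rel.vcomp_left a) (fun _ _ b => Rel.vcomp_right b)
  id_comp := by
    rintro p r ⟨η⟩
    exact Quot.sound (Rel.id_vcomp η)
  comp_id := by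
    rintro p r ⟨η⟩
    exact Quot.sound (Rel.vcomp_id η)
  assoc := by
    rintro p r s t ⟨η⟩ ⟨θ⟩ ⟨ι⟩
    exact Quot.sound (Rel.assoc η θ ι)

/-- The class of a formal composite. -/
def mk {a b : AdjEnd} {p r : a ⟶ b} (η : @Cell a b p r) : p ⟶ r := Quot.mk _ η

theorem mk_ofEq {a b : AdjEnd} {p r : a ⟶ b} (h : p = r) : mk (Cell.ofEq h) = eqToHom h := by
  subst h
  rfl

/-- Left whiskering in `AdjEnd`. -/
def whiskerL {a b c : AdjEnd} (p : a ⟶ b) {r s : b ⟶ c} (η : r ⟶ s) : p ≫ r ⟶ p ≫ s :=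
  Quot.map (@Cell.whiskerLeft a b c p r s) (fun _ _ => Rel.whisker_left p) η

/-- Right whiskering in `AdjEnd`. -/
def whiskerR {a b c : AdjEnd} {r s : a ⟶ b} (η : r ⟶ s) (p : b ⟶ c) : r ≫ p ⟶ s ≫ p :=
  Quot.map (fun η => @Cell.whiskerRight a b c r s η p) (fun _ _ => Rel.whisker_right p) η

theorem whiskerL_eqToHom {a b c : AdjEnd} (p : a ⟶ b) {r s : b ⟶ c} (h : r = s) :
    whiskerL p (eqToHom h) = eqToHom (congrArg (p ≫ ·) h) := by
  subst h
  exact Quot.sound (Rel.whiskerLeft_id p r)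

theorem whiskerR_eqToHom {a b c : AdjEnd} {r s : a ⟶ b} (h : r = s) (p : b ⟶ c) :
    whiskerR (eqToHom h) p = eqToHom (congrArg (· ≫ p) h) := by
  subst h
  exact Quot.sound (Rel.id_whiskerRight r p)

instance : Bicategory AdjEnd where
  homCategory := homCategory
  whiskerLeft p _ _ η := whiskerL p η
  whiskerRight η p := whiskerR η p
  associator p r s := eqToIso (Quiver.Path.comp_assoc p r s)
  leftUnitor p := eqToIso (Quiver.Path.nil_comp p)
  rightUnitor p := eqToIso (Quiver.Path.comp_nil p)
  whiskerLeft_id p r := Quot.sound (Rel.whiskerLeft_id p r)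
  whiskerLeft_comp := by
    rintro a b c p r s t ⟨η⟩ ⟨θ⟩
    exact Quot.sound (Rel.whiskerLeft_comp p η θ)
  id_whiskerLeft := by
    rintro a b p r ⟨η⟩
    refine (Quot.sound (Rel.id_whiskerLeft η)).trans ?_
    change (mk (Cell.ofEq _) ≫ mk η) ≫ mk (Cell.ofEq _) = _
    simp only [mk_ofEq, Category.assoc]
    rfl
  comp_whiskerLeft := by
    rintro a b c d p r s t ⟨η⟩
    refine (Quot.sound (Rel.comp_whiskerLeft p r η)).trans ?_
    change (mk (Cell.ofEq _) ≫ mk _) ≫ mk (Cell.ofEq _) = _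
    simp only [mk_ofEq, Category.assoc]
    rfl
  id_whiskerRight p r := Quot.sound (Rel.id_whiskerRight p r)
  comp_whiskerRight := by
    rintro a b c p r s ⟨η⟩ ⟨θ⟩ t
    exact Quot.sound (Rel.comp_whiskerRight η θ t)
  whiskerRight_id := by
    rintro a b p r ⟨η⟩
    refine (Quot.sound (Rel.whiskerRight_id η)).trans ?_
    change (mk (Cell.ofEq _) ≫ mk η) ≫ mk (Cell.ofEq _) = _
    simp only [mk_ofEq, Category.assoc]
    rfl
  whiskerRight_comp := by
    rintro a b c d p r ⟨η⟩ s t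
    refine (Quot.sound (Rel.whiskerRight_comp η s t)).trans ?_
    change (mk (Cell.ofEq _) ≫ mk _) ≫ mk (Cell.ofEq _) = _
    simp only [mk_ofEq, Category.assoc]
    rfl
  whisker_assoc := by
    rintro a b c d p r s ⟨η⟩ t
    refine (Quot.sound (Rel.whisker_assoc p η t)).trans ?_
    change (mk (Cell.ofEq _) ≫ mk _) ≫ mk (Cell.ofEq _) = _
    simp only [mk_ofEq, Category.assoc]
    rfl
  whisker_exchange := by
    rintro a b c p r s t ⟨η⟩ ⟨θ⟩
    exact Quot.sound (Rel.whisker_exchange η θ)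
  pentagon p r s t := by
    simp only [eqToIso.hom, whiskerL_eqToHom, whiskerR_eqToHom, eqToHom_trans]
  triangle p r := by
    simp only [eqToIso.hom, whiskerL_eqToHom, whiskerR_eqToHom, eqToHom_trans]

instance : Bicategory.Strict AdjEnd where
  id_comp p := Quiver.Path.nil_comp p
  comp_id p := Quiver.Path.comp_nil p
  assoc p r s := Quiver.Path.comp_assoc p r s
  leftUnitor_eqToIso _ := rfl
  rightUnitor_eqToIso _ := rfl
  associator_eqToIso _ _ _ := rfl

/-- The left adjoint `f : 0 → 1`. -/
def f : zero ⟶ one := letter Edge.f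

/-- The right adjoint `g : 1 → 0`. -/
def g : one ⟶ zero := letter Edge.g

/-- The free endomorphism `q : 0 → 0`. -/
def q : zero ⟶ zero := letter Edge.q

/-- The unit `u : 1 → g ∘ f`. -/
def u : 𝟙 zero ⟶ f ≫ g := mk Cell.unit

/-- The counit `c : f ∘ g → 1`. -/
def c : g ≫ f ⟶ 𝟙 one := mk Cell.counit

/-- The adjunction `f ⊣ g` in `AdjEnd`. -/
def adj : Bicategory.Adjunction f g where
  unit := u
  counit := c
  left_triangle := by
    have h : (u ▷ f ≫ (α_ f g f).hom) ≫ f ◁ c = (λ_ f).hom ≫ (ρ_ f).inv := by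
      have h₁ : (α_ f g f).hom = mk (Cell.ofEq (Quiver.Path.comp_assoc f g f)) := by
        rw [mk_ofEq]
        rfl
      have h₂ : (λ_ f).hom ≫ (ρ_ f).inv = mk (Cell.ofEq (Quiver.Path.nil_comp f)) := by
        rw [mk_ofEq, Bicategory.Strict.leftUnitor_eqToIso, Bicategory.Strict.rightUnitor_eqToIso,
          eqToIso.hom, eqToIso.inv, eqToHom_trans]
        rfl
      rw [h₁, h₂]
      exact Quot.sound Rel.left_triangle
    rw [← h, leftZigzag]
    bicategory
  right_triangle := by
    have h : (g ◁ u ≫ (α_ g f g).inv) ≫ c ▷ g = (ρ_ g).hom ≫ (λ_ g).inv := by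
      have h₁ : (α_ g f g).inv = mk (Cell.ofEq (Quiver.Path.comp_assoc g f g).symm) := by
        rw [mk_ofEq]
        rfl
      have h₂ : (ρ_ g).hom ≫ (λ_ g).inv = mk (Cell.ofEq (Quiver.Path.nil_comp g).symm) := by
        rw [mk_ofEq, Bicategory.Strict.leftUnitor_eqToIso, Bicategory.Strict.rightUnitor_eqToIso,
          eqToIso.hom, eqToIso.inv, eqToHom_trans]
        rfl
      rw [h₁, h₂]
      exact Quot.sound Rel.right_triangle
    rw [← h, rightZigzag]
    bicategory

end AdjEnd

namespace BiHH

section Restrict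

variable (A : Type u) [Bicategory.{w, v} A] (B : Type u') [Bicategory.{w', v'} B]

/-- Functoriality of `biHH`, as a functor `Fun(A, B) ⥤ Fun(biHH(A), biHH(B))`. -/
noncomputable def functorial : PseudoFun A B ⥤ (BiHH A ⥤ BiHH B) where
  obj P := map P.toPseudofunctor
  map {P P'} m := Quotient.lift (s := PseudoFun.transSetoid P P')
    (fun σ => mapTrans σ.trans σ.isLeftAdjoint)
    (fun σ τ e => mapTrans_congr e.some σ.isLeftAdjoint τ.isLeftAdjoint) m
  map_id P := mapTrans_id P.toPseudofunctor (PseudoFun.Trans.id P).isLeftAdjoint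
  map_comp := by
    rintro P P' Q ⟨σ⟩ ⟨τ⟩
    exact mapTrans_comp σ.trans τ.trans σ.isLeftAdjoint τ.isLeftAdjoint (σ.comp τ).isLeftAdjoint

variable {A}

/-- Restriction along a morphism `m` of `biHH(A)`, as a functor
`Fun(A, B) ⥤ Arr(biHH(B))`. -/
noncomputable def restrict {x y : BiHH A} (m : x ⟶ y) : PseudoFun A B ⥤ Arrow (BiHH B) where
  obj P := Arrow.mk ((map P.toPseudofunctor).map m)
  map σ := Arrow.homMk (((functorial A B).map σ).app x) (((functorial A B).map σ).app y)
    (((functorial A B).map σ).naturality m).symm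
  map_id P := by
    ext <;> simp <;> rfl
  map_comp σ τ := by
    ext <;> simp <;> rfl

end Restrict

section Trace

variable {A : Type u} [Bicategory.{w, v} A] {B : Type u'} [Bicategory.{w', v'} B]

/-- The `2`-morphism `uQu : Q → GFQGF` (here composites are written in diagrammatic order). -/
def insertUnits {C D : B} {F : C ⟶ D} {G : D ⟶ C} (adj : Bicategory.Adjunction F G) (Q : C ⟶ C) :
    Q ⟶ (F ≫ G) ≫ Q ≫ F ≫ G :=
  (λ_ Q).inv ≫ adj.unit ▷ Q ≫ (F ≫ G) ◁ ((ρ_ Q).inv ≫ Q ◁ adj.unit)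

/-- The `2`-morphism `FQGc : FQGFG → FQG` (here composites are written in diagrammatic order). -/
def applyCounit {C D : B} {F : C ⟶ D} {G : D ⟶ C} (adj : Bicategory.Adjunction F G) (Q : C ⟶ C) :
    (G ≫ F) ≫ G ≫ Q ≫ F ⟶ G ≫ Q ≫ F :=
  adj.counit ▷ (G ≫ Q ≫ F) ≫ (λ_ (G ≫ Q ≫ F)).hom

/-- The isomorphism `GFQGF ≅ FQGFG` of `biHH(B)` that rotates the last letter `G` of the
(diagrammatic) word to the front. -/
def traceIso {C D : B} (F : C ⟶ D) (G : D ⟶ C) (Q : C ⟶ C) :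
    of ((F ≫ G) ≫ Q ≫ F ≫ G) ≅ of ((G ≫ F) ≫ G ≫ Q ≫ F) :=
  cellIso (whiskerLeftIso (F ≫ G) (α_ Q F G).symm ≪≫ (α_ (F ≫ G) (Q ≫ F) G).symm ≪≫
      whiskerRightIso (α_ F G (Q ≫ F)) G) ≪≫
    rot (F ≫ G ≫ Q ≫ F) G ≪≫ cellIso (α_ G F (G ≫ Q ≫ F)).symm

/-- The trace `Q → GFQGF ≅ FQGFG → FQG` in `biHH(B)` of an endomorphism `Q : C → C` along an
adjunction `F ⊣ G` with `F : C → D`. -/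
def trace {C D : B} {F : C ⟶ D} {G : D ⟶ C} (adj : Bicategory.Adjunction F G) (Q : C ⟶ C) :
    of Q ⟶ of (G ≫ Q ≫ F) :=
  cell (insertUnits adj Q) ≫ (traceIso F G Q).hom ≫ cell (applyCounit adj Q)

theorem trace_eq {C D : B} {F : C ⟶ D} {G : D ⟶ C} (adj : Bicategory.Adjunction F G) (Q : C ⟶ C) :
    trace adj Q = cell ((ρ_ Q).inv ≫ Q ◁ adj.unit ≫ (α_ Q F G).inv) ≫ (rot (Q ≫ F) G).hom := by
  have e₁ : insertUnits adj Q ≫ (F ≫ G) ◁ (α_ Q F G).inv ≫ (α_ (F ≫ G) (Q ≫ F) G).inv ≫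
      (α_ F G (Q ≫ F)).hom ▷ G = ((ρ_ Q).inv ≫ Q ◁ adj.unit ≫ (α_ Q F G).inv) ≫
        ((λ_ (Q ≫ F)).inv ≫ adj.unit ▷ (Q ≫ F) ≫ (α_ F G (Q ≫ F)).hom) ▷ G := by
    calc
      _ = 𝟙 _ ⊗≫ (adj.unit ▷ (Q ≫ 𝟙 C) ≫ (F ≫ G) ◁ (Q ◁ adj.unit)) ⊗≫ 𝟙 _ := by
        unfold insertUnits
        bicategory
      _ = _ := by
        rw [← whisker_exchange]
        bicategory
  have e₂ : G ◁ ((λ_ (Q ≫ F)).inv ≫ adj.unit ▷ (Q ≫ F) ≫ (α_ F G (Q ≫ F)).hom) ≫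
      (α_ G F (G ≫ Q ≫ F)).inv ≫ applyCounit adj Q = 𝟙 _ := by
    calc
      _ = 𝟙 _ ⊗≫ rightZigzag adj.unit adj.counit ▷ (Q ≫ F) ⊗≫ 𝟙 _ := by
        unfold applyCounit rightZigzag
        bicategory
      _ = _ := by
        rw [adj.right_triangle]
        bicategory
  unfold trace traceIso
  simp only [cellIso, Iso.trans_hom, Iso.symm_hom, whiskerLeftIso_hom, whiskerRightIso_hom,
    Category.assoc, cell_comp_assoc, ← cell_comp]
  rw [e₁, slide_left, e₂, cell_id, Category.comp_id]

/-- The comparison `2`-isomorphism `P (G ≫ Q ≫ F) ≅ P G ≫ P Q ≫ P F` of a pseudofunctor. -/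
def mapComp₃ (P : A ⥤ᵖ B) {C D : A} (F : C ⟶ D) (G : D ⟶ C) (Q : C ⟶ C) :
    P.map (G ≫ Q ≫ F) ≅ P.map G ≫ P.map Q ≫ P.map F :=
  P.mapComp G (Q ≫ F) ≪≫ whiskerLeftIso (P.map G) (P.mapComp Q F)

theorem map_trace (P : A ⥤ᵖ B) {C D : A} {F : C ⟶ D} {G : D ⟶ C}
    (adj : Bicategory.Adjunction F G) (Q : C ⟶ C) :
    (map P).map (trace adj Q) ≫ cell (mapComp₃ P F G Q).hom =
      trace (P.mapAdjunction adj) (P.map Q) := by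
  rw [trace_eq, trace_eq, Functor.map_comp]
  change (cell (P.map₂ _) ≫ (cell (P.mapComp (Q ≫ F) G).hom ≫ (rot (P.map (Q ≫ F)) (P.map G)).hom ≫
    cell (P.mapComp G (Q ≫ F)).inv)) ≫ _ = _
  rw [rot_conj_left (P.mapComp Q F) (P.map G)]
  simp only [mapComp₃, Category.assoc, Iso.trans_hom, whiskerLeftIso_hom, cell_comp_assoc,
    ← cell_comp]
  rw [Iso.inv_hom_id_assoc, ← whiskerLeft_comp, Iso.inv_hom_id, whiskerLeft_id, cell_id,
    Category.comp_id]
  have h : P.map₂ (α_ Q F G).inv ≫ (P.mapComp (Q ≫ F) G).hom ≫ (P.mapComp Q F).hom ▷ P.map G =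
      (P.mapComp Q (F ≫ G)).hom ≫ P.map Q ◁ (P.mapComp F G).hom ≫
        (α_ (P.map Q) (P.map F) (P.map G)).inv := by
    rw [P.mapComp_assoc_right_hom_assoc, Iso.hom_inv_id, Category.comp_id]
  congr 2
  simp only [P.map₂_comp, Category.assoc, h, Pseudofunctor.mapAdjunction_unit]
  have h' : P.map₂ (ρ_ Q).inv ≫ (P.mapComp Q (𝟙 C)).hom =
      (ρ_ (P.map Q)).inv ≫ P.map Q ◁ (P.mapId C).inv := by
    rw [P.mapComp_id_right_hom, P.map₂_inv_hom_assoc]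
  simp [reassoc_of% h']

theorem conj_square {D : Type u} [Category.{v} D] {a a' b b' c c' : D} (e : b ≅ c) (e' : b' ≅ c')
    {p : a ⟶ b} {p' : a' ⟶ b'} {t : a ⟶ c} {t' : a' ⟶ c'} {x : a ⟶ a'} {y : b ⟶ b'}
    (h : p ≫ e.hom = t) (h' : p' ≫ e'.hom = t') (hxy : p ≫ y = x ≫ p') :
    x ≫ t' = t ≫ e.inv ≫ y ≫ e'.hom := by
  simp [← h, ← h', reassoc_of% hxy]

theorem conj_comp {D : Type u} [Category.{v} D] {b b' b'' c c' c'' : D} (e : b ≅ c) (e' : b' ≅ c')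
    (e'' : b'' ≅ c'') (y : b ⟶ b') (y' : b' ⟶ b'') :
    e.inv ≫ (y ≫ y') ≫ e''.hom = (e.inv ≫ y ≫ e'.hom) ≫ e'.inv ≫ y' ≫ e''.hom := by
  simp

end Trace

section TraceFunctor

variable (B : Type u) [Bicategory.{w, v} B]

/-- For a pseudofunctor `P` with `P(f) = F`, `P(g) = G`, `P(q) = Q`, the isomorphism of `biHH(B)`
between the image of the object `f ∘ q ∘ g` of `biHH(AdjEnd)` and `F ∘ Q ∘ G`. -/
def targetIso {B : Type u} [Bicategory.{w, v} B] (P : PseudoFun AdjEnd B) :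
    (map P.toPseudofunctor).obj (of (AdjEnd.g ≫ AdjEnd.q ≫ AdjEnd.f)) ≅
      of (P.toPseudofunctor.map AdjEnd.g ≫ P.toPseudofunctor.map AdjEnd.q ≫
        P.toPseudofunctor.map AdjEnd.f) :=
  cellIso (mapComp₃ P.toPseudofunctor AdjEnd.f AdjEnd.g AdjEnd.q)

/-- The trace functor: it takes a pseudofunctor `P` with `P(f) = F`, `P(g) = G`, `P(q) = Q` to the
trace `Q → GFQGF ≅ FQGFG → FQG` in `biHH(B)`, and a transformation to the morphisms that it
induces on `biHH(B)`. -/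
noncomputable def trHat : PseudoFun AdjEnd B ⥤ Arrow (BiHH B) where
  obj P := Arrow.mk (trace (P.toPseudofunctor.mapAdjunction AdjEnd.adj)
    (P.toPseudofunctor.map AdjEnd.q))
  map {P P'} σ := Arrow.homMk (((functorial AdjEnd B).map σ).app (of AdjEnd.q))
    ((targetIso P).inv ≫
      ((functorial AdjEnd B).map σ).app (of (AdjEnd.g ≫ AdjEnd.q ≫ AdjEnd.f)) ≫
        (targetIso P').hom)
    (conj_square (targetIso P) (targetIso P') (map_trace P.toPseudofunctor AdjEnd.adj AdjEnd.q)
      (map_trace P'.toPseudofunctor AdjEnd.adj AdjEnd.q)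
      (((functorial AdjEnd B).map σ).naturality (trace AdjEnd.adj AdjEnd.q)))
  map_id P := by
    refine Arrow.hom_ext _ _ ?_ ?_
    · exact congrArg (fun t => t.app (of AdjEnd.q)) ((functorial AdjEnd B).map_id P)
    · have h := congrArg (fun t => t.app (of (AdjEnd.g ≫ AdjEnd.q ≫ AdjEnd.f)))
        ((functorial AdjEnd B).map_id P)
      refine (congrArg (fun y => (targetIso P).inv ≫ y ≫ (targetIso P).hom) h).trans ?_
      exact (congrArg (fun y => (targetIso P).inv ≫ y) (Category.id_comp _)).trans
        (targetIso P).inv_hom_id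
  map_comp {P P' Q} σ τ := by
    refine Arrow.hom_ext _ _ ?_ ?_
    · exact congrArg (fun t => t.app (of AdjEnd.q)) ((functorial AdjEnd B).map_comp σ τ)
    · have h := congrArg (fun t => t.app (of (AdjEnd.g ≫ AdjEnd.q ≫ AdjEnd.f)))
        ((functorial AdjEnd B).map_comp σ τ)
      refine (congrArg (fun y => (targetIso P).inv ≫ y ≫ (targetIso Q).hom) h).trans ?_
      exact conj_comp (targetIso P) (targetIso P') (targetIso Q) _ _

end TraceFunctor


section CyclicDiagram

variable (B : Type u) [Bicategory.{w, v} B]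

/-- The category `∐ B(X₀, X₀)`. -/
abbrev Cyc₀ := Σ X : B, (X ⟶ X)

/-- The category `∐ B(X₀, X₁, X₀) = ∐ B(X₀, X₁) × B(X₁, X₀)`. -/
abbrev Cyc₁ := Σ p : B × B, (p.1 ⟶ p.2) × (p.2 ⟶ p.1)

/-- The category `∐ B(X₀, X₁, X₂, X₀) = ∐ B(X₀, X₁) × B(X₁, X₂) × B(X₂, X₀)`. -/
abbrev Cyc₂ := Σ p : B × B × B, (p.1 ⟶ p.2.1) × (p.2.1 ⟶ p.2.2) × (p.2.2 ⟶ p.1)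

variable {B}

/-- An object of `Cyc₀`. -/
abbrev cyc₀ {X : B} (F : X ⟶ X) : Cyc₀ B := ⟨X, F⟩

/-- An object of `Cyc₁`. -/
abbrev cyc₁ {X Y : B} (F : X ⟶ Y) (G : Y ⟶ X) : Cyc₁ B := ⟨(X, Y), (F, G)⟩

/-- An object of `Cyc₂`. -/
abbrev cyc₂ {X Y Z : B} (F : X ⟶ Y) (G : Y ⟶ Z) (H : Z ⟶ X) : Cyc₂ B :=
  ⟨(X, Y, Z), (F, G, H)⟩

/-- A morphism of `Cyc₀`. -/
abbrev cycHom₀ {X : B} {F F' : X ⟶ X} (α : F ⟶ F') : cyc₀ F ⟶ cyc₀ F' := Sigma.SigmaHom.mk α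

/-- A morphism of `Cyc₁`. -/
abbrev cycHom₁ {X Y : B} {F F' : X ⟶ Y} {G G' : Y ⟶ X} (α : F ⟶ F') (β : G ⟶ G') :
    cyc₁ F G ⟶ cyc₁ F' G' :=
  Sigma.SigmaHom.mk (C := fun p : B × B => (p.1 ⟶ p.2) × (p.2 ⟶ p.1)) (i := (X, Y))
    (X := (F, G)) (Y := (F', G')) (Prod.mkHom α β)

/-- A morphism of `Cyc₂`. -/
abbrev cycHom₂ {X Y Z : B} {F F' : X ⟶ Y} {G G' : Y ⟶ Z} {H H' : Z ⟶ X} (α : F ⟶ F')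
    (β : G ⟶ G') (γ : H ⟶ H') : cyc₂ F G H ⟶ cyc₂ F' G' H' :=
  Sigma.SigmaHom.mk
    (C := fun p : B × B × B => (p.1 ⟶ p.2.1) × (p.2.1 ⟶ p.2.2) × (p.2.2 ⟶ p.1))
    (i := (X, Y, Z)) (X := (F, G, H)) (Y := (F', G', H')) (Prod.mkHom α (Prod.mkHom β γ))

/-- The horizontal composite of two `2`-morphisms. -/
abbrev hcomp {X Y Z : B} {F F' : X ⟶ Y} {G G' : Y ⟶ Z} (α : F ⟶ F') (β : G ⟶ G') :
    F ≫ G ⟶ F' ≫ G' := α ▷ G ≫ F' ◁ β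

theorem hcomp_comp {X Y Z : B} {F F' F'' : X ⟶ Y} {G G' G'' : Y ⟶ Z} (α : F ⟶ F') (α' : F' ⟶ F'')
    (β : G ⟶ G') (β' : G' ⟶ G'') : hcomp (α ≫ α') (β ≫ β') = hcomp α β ≫ hcomp α' β' := by
  simp [hcomp, whisker_exchange_assoc]

theorem hcomp_id {X Y Z : B} (F : X ⟶ Y) (G : Y ⟶ Z) : hcomp (𝟙 F) (𝟙 G) = 𝟙 (F ≫ G) := by
  simp [hcomp]

variable (B)

/-- The face functor `d₀ (F, G) = F G`. -/
def face₀ : Cyc₁ B ⥤ Cyc₀ B :=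
  Sigma.desc fun _ =>
    { obj x := cyc₀ (x.1 ≫ x.2)
      map φ := cycHom₀ (hcomp φ.1 φ.2)
      map_id x := congrArg cycHom₀ (hcomp_id x.1 x.2)
      map_comp φ ψ := congrArg cycHom₀ (hcomp_comp φ.1 ψ.1 φ.2 ψ.2) }

/-- The face functor `d₁ (F, G) = G F`. -/
def face₁ : Cyc₁ B ⥤ Cyc₀ B :=
  Sigma.desc fun _ =>
    { obj x := cyc₀ (x.2 ≫ x.1)
      map φ := cycHom₀ (hcomp φ.2 φ.1)
      map_id x := congrArg cycHom₀ (hcomp_id x.2 x.1)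
      map_comp φ ψ := congrArg cycHom₀ (hcomp_comp φ.2 ψ.2 φ.1 ψ.1) }

/-- The face functor `d₀ (F, G, H) = (F G, H)`. -/
def face₂₀ : Cyc₂ B ⥤ Cyc₁ B :=
  Sigma.desc fun _ =>
    { obj x := cyc₁ (x.1 ≫ x.2.1) x.2.2
      map φ := cycHom₁ (hcomp φ.1 φ.2.1) φ.2.2
      map_id x := congrArg (fun α => cycHom₁ α (𝟙 x.2.2)) (hcomp_id x.1 x.2.1)
      map_comp φ ψ := congrArg (fun α => cycHom₁ α (φ.2.2 ≫ ψ.2.2))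
        (hcomp_comp φ.1 ψ.1 φ.2.1 ψ.2.1) }

/-- The face functor `d₁ (F, G, H) = (F, G H)`. -/
def face₂₁ : Cyc₂ B ⥤ Cyc₁ B :=
  Sigma.desc fun _ =>
    { obj x := cyc₁ x.1 (x.2.1 ≫ x.2.2)
      map φ := cycHom₁ φ.1 (hcomp φ.2.1 φ.2.2)
      map_id x := congrArg (fun α => cycHom₁ (𝟙 x.1) α) (hcomp_id x.2.1 x.2.2)
      map_comp φ ψ := congrArg (fun α => cycHom₁ (φ.1 ≫ ψ.1) α)
        (hcomp_comp φ.2.1 ψ.2.1 φ.2.2 ψ.2.2) }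

/-- The face functor `d₂ (F, G, H) = (H F, G)`. -/
def face₂₂ : Cyc₂ B ⥤ Cyc₁ B :=
  Sigma.desc fun _ =>
    { obj x := cyc₁ (x.2.2 ≫ x.1) x.2.1
      map φ := cycHom₁ (hcomp φ.2.2 φ.1) φ.2.1
      map_id x := congrArg (fun α => cycHom₁ α (𝟙 x.2.1)) (hcomp_id x.2.2 x.1)
      map_comp φ ψ := congrArg (fun α => cycHom₁ α (φ.2.1 ≫ ψ.2.1))
        (hcomp_comp φ.2.2 ψ.2.2 φ.1 ψ.1) }

/-- The degeneracy functor `s₀ (F) = (F, U)`. -/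
def degen : Cyc₀ B ⥤ Cyc₁ B :=
  Sigma.desc fun X =>
    { obj F := cyc₁ F (𝟙 X)
      map α := cycHom₁ α (𝟙 (𝟙 X))
      map_id _ := rfl
      map_comp α β := congrArg (cycHom₁ (α ≫ β)) (Category.id_comp (𝟙 (𝟙 X))).symm }

/-- The degeneracy functor `s₀ (F, G) = (F, U, G)`. -/
def degen₀ : Cyc₁ B ⥤ Cyc₂ B :=
  Sigma.desc fun p =>
    { obj x := cyc₂ x.1 (𝟙 p.2) x.2
      map φ := cycHom₂ φ.1 (𝟙 (𝟙 p.2)) φ.2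
      map_id _ := rfl
      map_comp φ ψ := congrArg (fun α => cycHom₂ (φ.1 ≫ ψ.1) α (φ.2 ≫ ψ.2))
        (Category.id_comp (𝟙 (𝟙 p.2))).symm }

/-- The degeneracy functor `s₁ (F, G) = (F, G, U)`. -/
def degen₁ : Cyc₁ B ⥤ Cyc₂ B :=
  Sigma.desc fun p =>
    { obj x := cyc₂ x.1 x.2 (𝟙 p.1)
      map φ := cycHom₂ φ.1 φ.2 (𝟙 (𝟙 p.1))
      map_id _ := rfl
      map_comp φ ψ := congrArg (fun α => cycHom₂ (φ.1 ≫ ψ.1) (φ.2 ≫ ψ.2) α)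
        (Category.id_comp (𝟙 (𝟙 p.1))).symm }

/-- A pseudo-cocone with vertex `D` under the `2`-truncated pseudo-simplicial diagram
`Cyc₀ ⇇ Cyc₁ ⇇ Cyc₂` of categories: functors to `D` on the three levels, natural isomorphisms for
the face and degeneracy functors, and a coherence condition for each simplicial identity. The
simplicial identities of the diagram hold up to the associators and unitors of `B`. -/
structure PseudoCocone (D : Type u') [Category.{v'} D] where
  /-- the functors on the three levels -/
  c₀ : Cyc₀ B ⥤ D
  c₁ : Cyc₁ B ⥤ D
  c₂ : Cyc₂ B ⥤ D
  /-- the isomorphisms for the face functors -/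
  d₀ : c₁ ≅ face₀ B ⋙ c₀
  d₁ : c₁ ≅ face₁ B ⋙ c₀
  e₀ : c₂ ≅ face₂₀ B ⋙ c₁
  e₁ : c₂ ≅ face₂₁ B ⋙ c₁
  e₂ : c₂ ≅ face₂₂ B ⋙ c₁
  /-- the isomorphisms for the degeneracy functors -/
  s : c₀ ≅ degen B ⋙ c₁
  t₀ : c₁ ≅ degen₀ B ⋙ c₂
  t₁ : c₁ ≅ degen₁ B ⋙ c₂
  /-- `d₀ d₁ = d₀ d₀` -/
  face_face₀₁ {X Y Z : B} (F : X ⟶ Y) (G : Y ⟶ Z) (H : Z ⟶ X) :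
    e₁.hom.app (cyc₂ F G H) ≫ d₀.hom.app (cyc₁ F (G ≫ H)) =
      e₀.hom.app (cyc₂ F G H) ≫ d₀.hom.app (cyc₁ (F ≫ G) H) ≫ c₀.map (cycHom₀ (α_ F G H).hom)
  /-- `d₀ d₂ = d₁ d₀` -/
  face_face₀₂ {X Y Z : B} (F : X ⟶ Y) (G : Y ⟶ Z) (H : Z ⟶ X) :
    e₂.hom.app (cyc₂ F G H) ≫ d₀.hom.app (cyc₁ (H ≫ F) G) =
      e₀.hom.app (cyc₂ F G H) ≫ d₁.hom.app (cyc₁ (F ≫ G) H) ≫ c₀.map (cycHom₀ (α_ H F G).inv)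
  /-- `d₁ d₂ = d₁ d₁` -/
  face_face₁₂ {X Y Z : B} (F : X ⟶ Y) (G : Y ⟶ Z) (H : Z ⟶ X) :
    e₂.hom.app (cyc₂ F G H) ≫ d₁.hom.app (cyc₁ (H ≫ F) G) =
      e₁.hom.app (cyc₂ F G H) ≫ d₁.hom.app (cyc₁ F (G ≫ H)) ≫ c₀.map (cycHom₀ (α_ G H F).hom)
  /-- `d₀ s₀ = 1` -/
  face_degen₀ {X : B} (F : X ⟶ X) :
    s.hom.app (cyc₀ F) ≫ d₀.hom.app (cyc₁ F (𝟙 X)) ≫ c₀.map (cycHom₀ (ρ_ F).hom) = 𝟙 _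
  /-- `d₁ s₀ = 1` -/
  face_degen₁ {X : B} (F : X ⟶ X) :
    s.hom.app (cyc₀ F) ≫ d₁.hom.app (cyc₁ F (𝟙 X)) ≫ c₀.map (cycHom₀ (λ_ F).hom) = 𝟙 _
  /-- `d₀ s₀ = 1` -/
  face_degen₀₀ {X Y : B} (F : X ⟶ Y) (G : Y ⟶ X) :
    t₀.hom.app (cyc₁ F G) ≫ e₀.hom.app (cyc₂ F (𝟙 Y) G) ≫
      c₁.map (cycHom₁ (ρ_ F).hom (𝟙 G)) = 𝟙 _
  /-- `d₁ s₀ = 1` -/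
  face_degen₁₀ {X Y : B} (F : X ⟶ Y) (G : Y ⟶ X) :
    t₀.hom.app (cyc₁ F G) ≫ e₁.hom.app (cyc₂ F (𝟙 Y) G) ≫
      c₁.map (cycHom₁ (𝟙 F) (λ_ G).hom) = 𝟙 _
  /-- `d₂ s₀ = s₀ d₁` -/
  face_degen₂₀ {X Y : B} (F : X ⟶ Y) (G : Y ⟶ X) :
    t₀.hom.app (cyc₁ F G) ≫ e₂.hom.app (cyc₂ F (𝟙 Y) G) =
      d₁.hom.app (cyc₁ F G) ≫ s.hom.app (cyc₀ (G ≫ F))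
  /-- `d₀ s₁ = s₀ d₀` -/
  face_degen₀₁ {X Y : B} (F : X ⟶ Y) (G : Y ⟶ X) :
    t₁.hom.app (cyc₁ F G) ≫ e₀.hom.app (cyc₂ F G (𝟙 X)) =
      d₀.hom.app (cyc₁ F G) ≫ s.hom.app (cyc₀ (F ≫ G))
  /-- `d₁ s₁ = 1` -/
  face_degen₁₁ {X Y : B} (F : X ⟶ Y) (G : Y ⟶ X) :
    t₁.hom.app (cyc₁ F G) ≫ e₁.hom.app (cyc₂ F G (𝟙 X)) ≫
      c₁.map (cycHom₁ (𝟙 F) (ρ_ G).hom) = 𝟙 _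
  /-- `d₂ s₁ = 1` -/
  face_degen₂₁ {X Y : B} (F : X ⟶ Y) (G : Y ⟶ X) :
    t₁.hom.app (cyc₁ F G) ≫ e₂.hom.app (cyc₂ F G (𝟙 X)) ≫
      c₁.map (cycHom₁ (λ_ F).hom (𝟙 G)) = 𝟙 _
  /-- `s₀ s₀ = s₁ s₀` -/
  degen_degen {X : B} (F : X ⟶ X) :
    s.hom.app (cyc₀ F) ≫ t₀.hom.app (cyc₁ F (𝟙 X)) =
      s.hom.app (cyc₀ F) ≫ t₁.hom.app (cyc₁ F (𝟙 X))

namespace PseudoCocone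

variable {B} {D : Type u'} [Category.{v'} D]

/-- A morphism of pseudo-cocones (a modification). -/
@[ext]
structure Hom (K L : PseudoCocone B D) where
  m₀ : K.c₀ ⟶ L.c₀
  m₁ : K.c₁ ⟶ L.c₁
  m₂ : K.c₂ ⟶ L.c₂
  d₀ : m₁ ≫ L.d₀.hom = K.d₀.hom ≫ Functor.whiskerLeft (face₀ B) m₀
  d₁ : m₁ ≫ L.d₁.hom = K.d₁.hom ≫ Functor.whiskerLeft (face₁ B) m₀
  e₀ : m₂ ≫ L.e₀.hom = K.e₀.hom ≫ Functor.whiskerLeft (face₂₀ B) m₁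
  e₁ : m₂ ≫ L.e₁.hom = K.e₁.hom ≫ Functor.whiskerLeft (face₂₁ B) m₁
  e₂ : m₂ ≫ L.e₂.hom = K.e₂.hom ≫ Functor.whiskerLeft (face₂₂ B) m₁
  s : m₀ ≫ L.s.hom = K.s.hom ≫ Functor.whiskerLeft (degen B) m₁
  t₀ : m₁ ≫ L.t₀.hom = K.t₀.hom ≫ Functor.whiskerLeft (degen₀ B) m₂
  t₁ : m₁ ≫ L.t₁.hom = K.t₁.hom ≫ Functor.whiskerLeft (degen₁ B) m₂

theorem paste {E : Type u} [Category.{v} E] {a b c x y z : E} {i : a ⟶ b} {j : b ⟶ c} {k : a ⟶ x}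
    {l : b ⟶ y} {m : c ⟶ z} {i' : x ⟶ y} {j' : y ⟶ z} (h : i ≫ l = k ≫ i') (h' : j ≫ m = l ≫ j') :
    (i ≫ j) ≫ m = k ≫ i' ≫ j' := by
  rw [Category.assoc, h', reassoc_of% h]

instance : Category (PseudoCocone B D) where
  Hom := Hom
  id K :=
    { m₀ := 𝟙 _, m₁ := 𝟙 _, m₂ := 𝟙 _
      d₀ := by simp
      d₁ := by simp
      e₀ := by simp
      e₁ := by simp
      e₂ := by simp
      s := by simp
      t₀ := by simp
      t₁ := by simp }
  comp m n :=
    { m₀ := m.m₀ ≫ n.m₀, m₁ := m.m₁ ≫ n.m₁, m₂ := m.m₂ ≫ n.m₂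
      d₀ := paste m.d₀ n.d₀
      d₁ := paste m.d₁ n.d₁
      e₀ := paste m.e₀ n.e₀
      e₁ := paste m.e₁ n.e₁
      e₂ := paste m.e₂ n.e₂
      s := paste m.s n.s
      t₀ := paste m.t₀ n.t₀
      t₁ := paste m.t₁ n.t₁ }
  id_comp _ := Hom.ext (Category.id_comp _) (Category.id_comp _) (Category.id_comp _)
  comp_id _ := Hom.ext (Category.comp_id _) (Category.comp_id _) (Category.comp_id _)
  assoc _ _ _ := Hom.ext (Category.assoc _ _ _) (Category.assoc _ _ _) (Category.assoc _ _ _)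

theorem map_square {E : Type u} [Category.{v} E] (P : E ⥤ D) {a b c d : E} {f : a ⟶ b} {g : b ⟶ d}
    {h : a ⟶ c} {k : c ⟶ d} (e : f ≫ g = h ≫ k) :
    P.map f ≫ P.map g = P.map h ≫ P.map k := by
  rw [← P.map_comp, e, P.map_comp]

theorem map_square' {E : Type u} [Category.{v} E] (P : E ⥤ D) {a b c x d : E} {f : a ⟶ b}
    {g : b ⟶ d} {h : a ⟶ c} {k : c ⟶ x} {l : x ⟶ d} (e : f ≫ g = h ≫ k ≫ l) :
    P.map f ≫ P.map g = P.map h ≫ P.map k ≫ P.map l := by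
  rw [← P.map_comp, e, P.map_comp, P.map_comp]

theorem map_triangle {E : Type u} [Category.{v} E] (P : E ⥤ D) {a b c : E} {f : a ⟶ b}
    {g : b ⟶ c} {h : c ⟶ a} (e : f ≫ g ≫ h = 𝟙 a) :
    P.map f ≫ P.map g ≫ P.map h = 𝟙 (P.obj a) := by
  rw [← P.map_comp, ← P.map_comp, e, P.map_id]

/-- The pseudo-cocone obtained by applying a functor to the vertex. -/
def postcompose {E : Type u} [Category.{v} E] {C : Type u'} [Bicategory.{w', v'} C]
    {V : Type u''} [Category.{v''} V] (K : PseudoCocone C E) (P : E ⥤ V) : PseudoCocone C V where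
  c₀ := K.c₀ ⋙ P
  c₁ := K.c₁ ⋙ P
  c₂ := K.c₂ ⋙ P
  d₀ := Functor.isoWhiskerRight K.d₀ P
  d₁ := Functor.isoWhiskerRight K.d₁ P
  e₀ := Functor.isoWhiskerRight K.e₀ P
  e₁ := Functor.isoWhiskerRight K.e₁ P
  e₂ := Functor.isoWhiskerRight K.e₂ P
  s := Functor.isoWhiskerRight K.s P
  t₀ := Functor.isoWhiskerRight K.t₀ P
  t₁ := Functor.isoWhiskerRight K.t₁ P
  face_face₀₁ F G H := map_square' P (K.face_face₀₁ F G H)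
  face_face₀₂ F G H := map_square' P (K.face_face₀₂ F G H)
  face_face₁₂ F G H := map_square' P (K.face_face₁₂ F G H)
  face_degen₀ F := map_triangle P (K.face_degen₀ F)
  face_degen₁ F := map_triangle P (K.face_degen₁ F)
  face_degen₀₀ F G := map_triangle P (K.face_degen₀₀ F G)
  face_degen₁₀ F G := map_triangle P (K.face_degen₁₀ F G)
  face_degen₂₀ F G := map_square P (K.face_degen₂₀ F G)
  face_degen₀₁ F G := map_square P (K.face_degen₀₁ F G)
  face_degen₁₁ F G := map_triangle P (K.face_degen₁₁ F G)
  face_degen₂₁ F G := map_triangle P (K.face_degen₂₁ F G)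
  degen_degen F := map_square P (K.degen_degen F)

/-- The functor `Fun(E, V) ⥤ PseudoCocone(V)` given by a pseudo-cocone with vertex `E`. The
pseudo-cocone is a pseudo-colimit if this is an equivalence for every category `V`. -/
def comparison {E : Type u} [Category.{v} E] {C : Type u'} [Bicategory.{w', v'} C]
    (K : PseudoCocone C E) (V : Type u'') [Category.{v''} V] : (E ⥤ V) ⥤ PseudoCocone C V where
  obj P := K.postcompose P
  map {P Q} t :=
    { m₀ := Functor.whiskerLeft K.c₀ t
      m₁ := Functor.whiskerLeft K.c₁ t
      m₂ := Functor.whiskerLeft K.c₂ t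
      d₀ := by
        ext x
        exact (t.naturality (K.d₀.hom.app x)).symm
      d₁ := by
        ext x
        exact (t.naturality (K.d₁.hom.app x)).symm
      e₀ := by
        ext x
        exact (t.naturality (K.e₀.hom.app x)).symm
      e₁ := by
        ext x
        exact (t.naturality (K.e₁.hom.app x)).symm
      e₂ := by
        ext x
        exact (t.naturality (K.e₂.hom.app x)).symm
      s := by
        ext x
        exact (t.naturality (K.s.hom.app x)).symm
      t₀ := by
        ext x
        exact (t.naturality (K.t₀.hom.app x)).symm
      t₁ := by
        ext x
        exact (t.naturality (K.t₁.hom.app x)).symm }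
  map_id _ := rfl
  map_comp _ _ := rfl

end PseudoCocone

section Canonical

/-- The functor from `∐ B(X₀, X₀)` to `biHH(B)`. -/
def incl₀ : Cyc₀ B ⥤ BiHH B :=
  Sigma.desc fun _ =>
    { obj F := of F
      map α := cell α
      map_id F := cell_id F
      map_comp α β := cell_comp α β }

/-- The canonical pseudo-cocone with vertex `biHH(B)`, in which `d₀ ≅ d₁` is given by the
isomorphisms `(F, G) : F G ≅ G F`. -/
def canonical : PseudoCocone B (BiHH B) where
  c₀ := incl₀ B
  c₁ := face₀ B ⋙ incl₀ B
  c₂ := face₂₀ B ⋙ face₀ B ⋙ incl₀ B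
  d₀ := Iso.refl _
  d₁ := NatIso.ofComponents (fun x => rot x.2.1 x.2.2) (by
    rintro ⟨p, x⟩ ⟨_, y⟩ ⟨φ⟩
    exact rot_naturality φ.1 φ.2)
  e₀ := Iso.refl _
  e₁ := NatIso.ofComponents (fun x => cellIso (α_ x.2.1 x.2.2.1 x.2.2.2)) (by
    rintro ⟨p, x⟩ ⟨_, y⟩ ⟨φ⟩
    change cell (hcomp (hcomp φ.1 φ.2.1) φ.2.2) ≫ cell _ =
      cell _ ≫ cell (hcomp φ.1 (hcomp φ.2.1 φ.2.2))
    rw [← cell_comp, ← cell_comp]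
    congr 1
    simp [hcomp])
  e₂ := NatIso.ofComponents
    (fun x => rot (x.2.1 ≫ x.2.2.1) x.2.2.2 ≪≫ cellIso (α_ x.2.2.2 x.2.1 x.2.2.1).symm) (by
    rintro ⟨p, x⟩ ⟨_, y⟩ ⟨φ⟩
    change cell (hcomp (hcomp φ.1 φ.2.1) φ.2.2) ≫ (rot _ _).hom ≫ cell (α_ _ _ _).inv =
      ((rot _ _).hom ≫ cell (α_ _ _ _).inv) ≫ cell (hcomp (hcomp φ.2.2 φ.1) φ.2.1)
    rw [← Category.assoc, rot_naturality, Category.assoc, Category.assoc, ← cell_comp, ← cell_comp]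
    congr 2
    simp [hcomp])
  s := NatIso.ofComponents (fun x => cellIso (ρ_ x.2).symm) (by
    rintro ⟨p, x⟩ ⟨_, y⟩ ⟨φ⟩
    change cell φ ≫ cell (ρ_ _).inv = cell (ρ_ _).inv ≫ cell (hcomp φ (𝟙 (𝟙 _)))
    rw [← cell_comp, ← cell_comp]
    congr 1
    simp [hcomp])
  t₀ := NatIso.ofComponents (fun x => cellIso (whiskerRightIso (ρ_ x.2.1).symm x.2.2)) (by
    rintro ⟨p, x⟩ ⟨_, y⟩ ⟨φ⟩
    change cell (hcomp φ.1 φ.2) ≫ cell ((ρ_ _).inv ▷ _) =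
      cell ((ρ_ _).inv ▷ _) ≫ cell (hcomp (hcomp φ.1 (𝟙 (𝟙 _))) φ.2)
    rw [← cell_comp, ← cell_comp]
    congr 1
    rw [hcomp, Category.assoc, whisker_exchange]
    simp [hcomp])
  t₁ := NatIso.ofComponents (fun x => cellIso (ρ_ (x.2.1 ≫ x.2.2)).symm) (by
    rintro ⟨p, x⟩ ⟨_, y⟩ ⟨φ⟩
    change cell (hcomp φ.1 φ.2) ≫ cell (ρ_ _).inv =
      cell (ρ_ _).inv ≫ cell (hcomp (hcomp φ.1 φ.2) (𝟙 (𝟙 _)))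
    rw [← cell_comp, ← cell_comp]
    congr 1
    simp [hcomp])
  face_face₀₁ F G H := by
    change cell (α_ F G H).hom ≫ 𝟙 _ = 𝟙 _ ≫ 𝟙 _ ≫ cell (α_ F G H).hom
    simp
  face_face₀₂ F G H := by
    change ((rot (F ≫ G) H).hom ≫ cell (α_ H F G).inv) ≫ 𝟙 _ =
      𝟙 _ ≫ (rot (F ≫ G) H).hom ≫ cell (α_ H F G).inv
    simp
  face_face₁₂ F G H := by
    change ((rot (F ≫ G) H).hom ≫ cell (α_ H F G).inv) ≫ (rot (H ≫ F) G).hom =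
      cell (α_ F G H).hom ≫ (rot F (G ≫ H)).hom ≫ cell (α_ G H F).hom
    rw [rot_comp]
    simp only [Category.assoc, cell_comp_assoc, ← cell_comp]
    simp
  face_degen₀ F := by
    change cell (ρ_ F).inv ≫ 𝟙 _ ≫ cell (ρ_ F).hom = 𝟙 (of F)
    rw [Category.id_comp, ← cell_comp, Iso.inv_hom_id, cell_id]
  face_degen₁ F := by
    change cell (ρ_ F).inv ≫ (rot F (𝟙 _)).hom ≫ cell (λ_ F).hom = 𝟙 (of F)
    rw [rot_id, ← cell_comp, Iso.inv_hom_id, cell_id]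
  face_degen₀₀ F G := by
    change cell ((ρ_ F).inv ▷ G) ≫ 𝟙 _ ≫ cell (hcomp (ρ_ F).hom (𝟙 G)) = 𝟙 (of (F ≫ G))
    rw [Category.id_comp, ← cell_comp, ← cell_id]
    congr 1
    simp [hcomp]
  face_degen₁₀ F G := by
    change cell ((ρ_ F).inv ▷ G) ≫ cell (α_ F (𝟙 _) G).hom ≫ cell (hcomp (𝟙 F) (λ_ G).hom) =
      𝟙 (of (F ≫ G))
    rw [← cell_comp, ← cell_comp, ← cell_id]
    congr 1
    simp [hcomp]
  face_degen₂₀ {X Y} F G := by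
    change cell ((ρ_ F).inv ▷ G) ≫ (rot (F ≫ 𝟙 Y) G).hom ≫ cell (α_ G F (𝟙 Y)).inv =
      (rot F G).hom ≫ cell (ρ_ (G ≫ F)).inv
    rw [← Category.assoc, rot_naturality_left, Category.assoc, ← cell_comp]
    congr 2
    simp
  face_degen₀₁ F G := by
    change cell (ρ_ (F ≫ G)).inv ≫ 𝟙 _ = 𝟙 _ ≫ cell (ρ_ (F ≫ G)).inv
    simp
  face_degen₁₁ {X Y} F G := by
    change cell (ρ_ (F ≫ G)).inv ≫ cell (α_ F G (𝟙 X)).hom ≫ cell (hcomp (𝟙 F) (ρ_ G).hom) =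
      𝟙 (of (F ≫ G))
    rw [← cell_comp, ← cell_comp, ← cell_id]
    congr 1
    simp [hcomp]
  face_degen₂₁ {X Y} F G := by
    change cell (ρ_ (F ≫ G)).inv ≫ ((rot (F ≫ G) (𝟙 X)).hom ≫ cell (α_ (𝟙 X) F G).inv) ≫
      cell (hcomp (λ_ F).hom (𝟙 G)) = 𝟙 (of (F ≫ G))
    rw [Category.assoc, ← cell_comp]
    have h : (α_ (𝟙 X) F G).inv ≫ hcomp (λ_ F).hom (𝟙 G) = (λ_ (F ≫ G)).hom := by
      simp [hcomp]
    rw [h, rot_id, ← cell_comp, Iso.inv_hom_id, cell_id]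
  degen_degen {X} F := by
    change cell (ρ_ F).inv ≫ cell ((ρ_ F).inv ▷ 𝟙 X) = cell (ρ_ F).inv ≫ cell (ρ_ (F ≫ 𝟙 X)).inv
    rw [← cell_comp, ← cell_comp]
    congr 1
    bicategory

end Canonical

end CyclicDiagram

section AdjEndObjects

/-- The object `∅1` of `biHH(AdjEnd)`, given by the word `q`. -/
def emptyOne : BiHH AdjEnd := of AdjEnd.q

/-- The object `[0]1` of `biHH(AdjEnd)`, given by the word `g ∘ f ∘ q`. -/
def zeroOne : BiHH AdjEnd := of (AdjEnd.q ≫ AdjEnd.f ≫ AdjEnd.g)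

/-- The morphism `∅1 → [0]1` of `biHH(AdjEnd)` given by the unit `u : 1 → g ∘ f`. -/
def unitArrow : emptyOne ⟶ zeroOne := cell ((ρ_ AdjEnd.q).inv ≫ AdjEnd.q ◁ AdjEnd.u)

/-- The isomorphism of `biHH(AdjEnd)` between `[0]1` and the word `f ∘ q ∘ g` that is given by the
rotation of the letter `g`. -/
def zeroOneIso : zeroOne ≅ of (AdjEnd.g ≫ AdjEnd.q ≫ AdjEnd.f) :=
  cellIso (α_ AdjEnd.q AdjEnd.f AdjEnd.g).symm ≪≫ rot (AdjEnd.q ≫ AdjEnd.f) AdjEnd.g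

end AdjEndObjects

end BiHH

/-! A pseudo-cocone carries redundant data, and this is why part (0) holds. Its isomorphisms `d₀`
and `e₀` identify the two upper levels with faces of the bottom one, so a morphism of pseudo-cocones
is determined on `Cyc₀` (`PseudoCocone.hom_ext_zero`), and the structure that remains is the
isomorphism `d₀⁻¹ ≫ d₁` from the image of `F ≫ G` to that of `G ≫ F`. The three face identities on
`Cyc₂` say that it is multiplicative, the degeneracy identities say that it is trivial at a unit,
and these are the relations of the presentation of `biHH(B)`.

The other parts rest on a computation of the morphisms out of `q` in `biHH(AdjEnd)`. Turning a loop
once around, by `rot (𝟙 X) F`, is an automorphism of the identity functor (`twist`), and `(F, G)`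
followed by `(G, F)` is one full turn (`rot_hom_rot_hom`). Inverse rotations are therefore rotations
up to turns, and turns commute with everything. Since `q` is free, a `2`-morphism out of `R ≫ q ≫ S`
acts on `R` and on `S` separately (`splits`). So every morphism out of `q` has a normal form: a
power of the turn, the insertion of letters by some `𝟙 ⟶ S ≫ R`, and the rotation of `R` to the
front (`isSpin`).

The inserted `2`-morphism is no choice: there is at most one `2`-morphism from `𝟙 zero` to any word
(`hom_id_subsingleton`). This reflects that the endomorphisms of `0` in the free adjunction form the
augmented simplex category, in which the empty ordinal is initial. Only the exponent of the turn is
left, and it is detected by the winding number, a functor to `ℤ` that counts the letters `q` moved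
past the base point.

Hence `Aut(∅1)` is `ℤ` and acts simply transitively on the morphisms `∅1 → [0]1`. The trace is one
of these up to the rotation `κ`, by `trace_eq`; centrality lets a turn be moved into the isomorphism
in the middle of the trace; and the identity pseudofunctor distinguishes the restriction functors.
-/

namespace BiHH

/-! ### Part (0): the universal property of `biHH(B)`. -/

section PseudoColimit

variable {B : Type u} [Bicategory.{w, v} B] {V : Type u'} [Category.{v'} V]

/-- Two morphisms of pseudo-cocones agree if they agree on the bottom level. -/
theorem PseudoCocone.hom_ext_zero {K L : PseudoCocone B V} (m n : K ⟶ L)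
    (h : PseudoCocone.Hom.m₀ m = PseudoCocone.Hom.m₀ n) : m = n := by
  have h₁ : PseudoCocone.Hom.m₁ m = PseudoCocone.Hom.m₁ n := by
    rw [← cancel_mono L.d₀.hom, PseudoCocone.Hom.d₀ m, PseudoCocone.Hom.d₀ n, h]
  have h₂ : PseudoCocone.Hom.m₂ m = PseudoCocone.Hom.m₂ n := by
    rw [← cancel_mono L.e₀.hom, PseudoCocone.Hom.e₀ m, PseudoCocone.Hom.e₀ n, h₁]
  exact PseudoCocone.Hom.ext h h₁ h₂

theorem inv_square {D : Type u'} [Category.{v'} D] {a b x y : D} (m : a ≅ b) (n : x ≅ y)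
    {i : a ⟶ x} {j : b ⟶ y}
    (h : m.hom ≫ j = i ≫ n.hom) : m.inv ≫ i = j ≫ n.inv := by
  rw [Iso.inv_comp_eq, ← Category.assoc, h, Category.assoc, Iso.hom_inv_id, Category.comp_id]

/-- An isomorphism of pseudo-cocones from isomorphisms on the three levels. -/
def PseudoCocone.isoMk {K L : PseudoCocone B V} (m₀ : K.c₀ ≅ L.c₀) (m₁ : K.c₁ ≅ L.c₁)
    (m₂ : K.c₂ ≅ L.c₂)
    (d₀ : m₁.hom ≫ L.d₀.hom = K.d₀.hom ≫ Functor.whiskerLeft (face₀ B) m₀.hom)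
    (d₁ : m₁.hom ≫ L.d₁.hom = K.d₁.hom ≫ Functor.whiskerLeft (face₁ B) m₀.hom)
    (e₀ : m₂.hom ≫ L.e₀.hom = K.e₀.hom ≫ Functor.whiskerLeft (face₂₀ B) m₁.hom)
    (e₁ : m₂.hom ≫ L.e₁.hom = K.e₁.hom ≫ Functor.whiskerLeft (face₂₁ B) m₁.hom)
    (e₂ : m₂.hom ≫ L.e₂.hom = K.e₂.hom ≫ Functor.whiskerLeft (face₂₂ B) m₁.hom)
    (s : m₀.hom ≫ L.s.hom = K.s.hom ≫ Functor.whiskerLeft (degen B) m₁.hom)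
    (t₀ : m₁.hom ≫ L.t₀.hom = K.t₀.hom ≫ Functor.whiskerLeft (degen₀ B) m₂.hom)
    (t₁ : m₁.hom ≫ L.t₁.hom = K.t₁.hom ≫ Functor.whiskerLeft (degen₁ B) m₂.hom) : K ≅ L where
  hom := PseudoCocone.Hom.mk m₀.hom m₁.hom m₂.hom d₀ d₁ e₀ e₁ e₂ s t₀ t₁
  inv := PseudoCocone.Hom.mk m₀.inv m₁.inv m₂.inv
    (inv_square m₁ (Functor.isoWhiskerLeft (face₀ B) m₀) d₀)
    (inv_square m₁ (Functor.isoWhiskerLeft (face₁ B) m₀) d₁)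
    (inv_square m₂ (Functor.isoWhiskerLeft (face₂₀ B) m₁) e₀)
    (inv_square m₂ (Functor.isoWhiskerLeft (face₂₁ B) m₁) e₁)
    (inv_square m₂ (Functor.isoWhiskerLeft (face₂₂ B) m₁) e₂)
    (inv_square m₀ (Functor.isoWhiskerLeft (degen B) m₁) s)
    (inv_square m₁ (Functor.isoWhiskerLeft (degen₀ B) m₂) t₀)
    (inv_square m₁ (Functor.isoWhiskerLeft (degen₁ B) m₂) t₁)
  hom_inv_id := PseudoCocone.hom_ext_zero _ _ m₀.hom_inv_id
  inv_hom_id := PseudoCocone.hom_ext_zero _ _ m₀.inv_hom_id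

theorem rot_naturality_of_squares {D : Type u'} [Category.{v'} D] {a a' b b' c c' : D}
    {d₀ : a ≅ b} {d₁ : a ≅ c} {d₀' : a' ≅ b'} {d₁' : a' ≅ c'} {m : a ⟶ a'} {n : b ⟶ b'}
    {p : c ⟶ c'} (h₀ : m ≫ d₀'.hom = d₀.hom ≫ n) (h₁ : m ≫ d₁'.hom = d₁.hom ≫ p) :
    n ≫ (d₀'.symm ≪≫ d₁').hom = (d₀.symm ≪≫ d₁).hom ≫ p := by
  simp only [Iso.trans_hom, Iso.symm_hom, Category.assoc]
  rw [← h₁, ← cancel_epi d₀.hom, ← reassoc_of% h₀]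
  simp

/-- The composites `s ≫ d₀` and `s ≫ d₁` are inverse to `r` and `l`, so `d₀⁻¹ ≫ d₁` compares the two
unitors. -/
theorem rot_id_of_triangles {D : Type u'} [Category.{v'} D] {a b c e : D} {d₀ : a ≅ b} {d₁ : a ≅ c}
    {s : e ≅ a} {l : c ⟶ e} {r : b ⟶ e} (h₀ : s.hom ≫ d₀.hom ≫ r = 𝟙 e)
    (h₁ : s.hom ≫ d₁.hom ≫ l = 𝟙 e) : (d₀.symm ≪≫ d₁).hom ≫ l = r := by
  rw [← cancel_epi d₀.hom, ← cancel_epi s.hom, h₀, ← h₁]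
  simp

/-- The objects `aᵢ` are the faces of a `2`-simplex with centre `t`, and each hypothesis identifies
a vertex shared by two faces. Every rotation can be routed through `t`; on the right-hand side the
passages through `t` cancel except for the first and the last. -/
theorem rot_comp_of_faces {D : Type u'} [Category.{v'} D] {t a₀ a₁ a₂ b₀ b₁ b₂ c₀ c₁ c₂ : D}
    {e₀ : t ≅ a₀} {e₁ : t ≅ a₁} {e₂ : t ≅ a₂} {p₀ : a₀ ≅ b₀} {q₀ : a₀ ≅ c₀} {p₁ : a₁ ≅ b₁}
    {q₁ : a₁ ≅ c₁} {p₂ : a₂ ≅ b₂} {q₂ : a₂ ≅ c₂} {x : b₁ ≅ b₀} {y : c₀ ≅ b₂} {z : c₂ ≅ c₁}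
    (h₀₁ : e₁.hom ≫ p₁.hom = e₀.hom ≫ p₀.hom ≫ x.inv)
    (h₀₂ : e₂.hom ≫ p₂.hom = e₀.hom ≫ q₀.hom ≫ y.hom)
    (h₁₂ : e₂.hom ≫ q₂.hom = e₁.hom ≫ q₁.hom ≫ z.inv) :
    (p₁.symm ≪≫ q₁).hom = x.hom ≫ (p₀.symm ≪≫ q₀).hom ≫ y.hom ≫ (p₂.symm ≪≫ q₂).hom ≫ z.hom := by
  have h₁ : q₁.hom = e₁.inv ≫ e₂.hom ≫ q₂.hom ≫ z.hom := by
    rw [reassoc_of% h₁₂]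
    simp
  have h₂ : y.hom = q₀.inv ≫ e₀.inv ≫ e₂.hom ≫ p₂.hom := by
    rw [h₀₂]
    simp
  have h₃ : x.hom ≫ p₀.inv ≫ e₀.inv = p₁.inv ≫ e₁.inv := by
    rw [← cancel_epi p₁.hom, ← cancel_epi e₁.hom, reassoc_of% h₀₁]
    simp
  simp only [Iso.trans_hom, Iso.symm_hom, Category.assoc]
  rw [h₁, h₂]
  simp [reassoc_of% h₃]

/-- The image of an invertible `2`-morphism under a functor on `∐ B(X₀, X₀)`. -/
def mapCycIso₀ (P : Cyc₀ B ⥤ V) {X : B} {F G : X ⟶ X} (α : F ≅ G) :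
    P.obj (cyc₀ F) ≅ P.obj (cyc₀ G) :=
  P.mapIso ⟨cycHom₀ α.hom, cycHom₀ α.inv, congrArg cycHom₀ α.hom_inv_id,
    congrArg cycHom₀ α.inv_hom_id⟩

/-- A pseudo-cocone determines the data of a functor out of `biHH(B)`. -/
def PseudoCocone.liftData (K : PseudoCocone B V) : LiftData B V where
  obj F := K.c₀.obj (cyc₀ F)
  cell α := K.c₀.map (cycHom₀ α)
  rot F G := (K.d₀.app (cyc₁ F G)).symm ≪≫ K.d₁.app (cyc₁ F G)
  cell_id F := K.c₀.map_id (cyc₀ F)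
  cell_comp α β := K.c₀.map_comp (cycHom₀ α) (cycHom₀ β)
  rot_naturality α β :=
    rot_naturality_of_squares (K.d₀.hom.naturality (cycHom₁ α β))
      (K.d₁.hom.naturality (cycHom₁ α β))
  rot_comp F G H :=
    rot_comp_of_faces (e₀ := K.e₀.app (cyc₂ F G H)) (e₁ := K.e₁.app (cyc₂ F G H))
      (e₂ := K.e₂.app (cyc₂ F G H)) (p₀ := K.d₀.app (cyc₁ (F ≫ G) H))
      (q₀ := K.d₁.app (cyc₁ (F ≫ G) H)) (p₁ := K.d₀.app (cyc₁ F (G ≫ H)))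
      (q₁ := K.d₁.app (cyc₁ F (G ≫ H))) (p₂ := K.d₀.app (cyc₁ (H ≫ F) G))
      (q₂ := K.d₁.app (cyc₁ (H ≫ F) G)) (x := mapCycIso₀ K.c₀ (α_ F G H).symm)
      (y := mapCycIso₀ K.c₀ (α_ H F G).symm) (z := mapCycIso₀ K.c₀ (α_ G H F).symm)
      (K.face_face₀₁ F G H) (K.face_face₀₂ F G H) (K.face_face₁₂ F G H)
  rot_id F :=
    rot_id_of_triangles (d₀ := K.d₀.app (cyc₁ F (𝟙 _))) (d₁ := K.d₁.app (cyc₁ F (𝟙 _)))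
      (s := K.s.app (cyc₀ F)) (K.face_degen₀ F) (K.face_degen₁ F)

theorem comparison_faithful : ((canonical B).comparison V).Faithful where
  map_injective {P Q t t'} h := by
    ext x
    exact congrArg (fun m => (PseudoCocone.Hom.m₀ m).app (cyc₀ x.loop)) h

/-- In the canonical pseudo-cocone `d₀` is an identity and `d₁` is a rotation `r`. Compatibility
with `d₀` forces `m₁ = m`, and compatibility with `d₁` is then naturality along `r`. -/
theorem naturality_of_faces {C : Type u''} [Category.{v''} C] {P Q : C ⥤ V} {x y : C} {r : x ⟶ y}
    {m₁ m : P.obj x ⟶ Q.obj x} {m' : P.obj y ⟶ Q.obj y}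
    (h₀ : m₁ ≫ Q.map (𝟙 x) = P.map (𝟙 x) ≫ m) (h₁ : m₁ ≫ Q.map r = P.map r ≫ m') :
    P.map r ≫ m' = m ≫ Q.map r := by
  rw [← h₁, ← cancel_epi (P.map (𝟙 x)), ← Category.assoc _ m, ← h₀]
  simp

theorem comparison_full : ((canonical B).comparison V).Full where
  map_surjective {P Q} m := by
    let m₀ {X : B} (F : X ⟶ X) : P.obj (of F) ⟶ Q.obj (of F) :=
      (PseudoCocone.Hom.m₀ m).app (cyc₀ F)
    let t : P ⟶ Q :=
      { app x := m₀ x.loop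
        naturality _ _ k := by
          refine naturality_of_generators (P := P) (Q := Q) (fun x => m₀ x.loop) ?_ ?_ k
          · exact fun α => (PseudoCocone.Hom.m₀ m).naturality (cycHom₀ α)
          · intro X Y F G
            have h₀ := NatTrans.congr_app (PseudoCocone.Hom.d₀ m) (cyc₁ F G)
            have h₁ := NatTrans.congr_app (PseudoCocone.Hom.d₁ m) (cyc₁ F G)
            exact naturality_of_faces (P := P) (Q := Q) h₀ h₁ }
    exact ⟨t, PseudoCocone.hom_ext_zero _ _ (by ext x; rfl)⟩

theorem comp_rot_comp {a b c d e t : V} {e₀ : t ⟶ a} {d₀ : a ≅ b} {d₁ : a ≅ c} {y : c ⟶ d}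
    {e₂ : t ⟶ e} {p : e ⟶ d} (h : e₂ ≫ p = e₀ ≫ d₁.hom ≫ y) :
    (e₀ ≫ d₀.hom) ≫ (d₀.symm ≪≫ d₁).hom ≫ y = e₂ ≫ p := by
  simp [h]

/-- This is the identity `d₀ s₀ = 1` solved for the unitor. It matches `K.s` with the degeneracy
isomorphism of the canonical pseudo-cocone, which is an inverse right unitor. -/
theorem unit_face (K : PseudoCocone B V) {X : B} (F : X ⟶ X) :
    K.c₀.map (cycHom₀ (ρ_ F).inv) =
      K.s.hom.app (cyc₀ F) ≫ K.d₀.hom.app (cyc₁ F (𝟙 X)) := by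
  have h : (_ ≫ _) ≫ (mapCycIso₀ K.c₀ (ρ_ F)).hom = 𝟙 _ :=
    (Category.assoc _ _ _).trans (K.face_degen₀ F)
  exact ((Iso.comp_hom_eq_id _).1 h).symm

theorem degen_square {a a' b b' t : V} {t₀ : a ⟶ t} {e₀ : t ⟶ a'} {c : a' ⟶ a} {d : a ⟶ b}
    {d' : a' ⟶ b'} {x : b' ≅ b} (h : c ≫ d = d' ≫ x.hom) (h' : t₀ ≫ e₀ ≫ c = 𝟙 a) :
    d ≫ x.inv = t₀ ≫ e₀ ≫ d' := by
  rw [Iso.comp_inv_eq, Category.assoc, Category.assoc, ← h, ← Category.assoc e₀,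
    ← Category.assoc, h', Category.id_comp]

theorem comp_comp_of_unit_face {a b c d t : V} {t₁ : a ⟶ t} {e₀ : t ⟶ c} {d₀ : a ⟶ b} {s : b ⟶ c}
    {r : b ⟶ d} {d₀' : c ⟶ d} (h : t₁ ≫ e₀ = d₀ ≫ s) (h' : r = s ≫ d₀') :
    d₀ ≫ r = t₁ ≫ e₀ ≫ d₀' := by
  rw [h', ← reassoc_of% h]

theorem comparison_essSurj : ((canonical B).comparison V).EssSurj where
  mem_essImage K := by
    refine ⟨K.liftData.functor, ⟨Iso.symm (PseudoCocone.isoMk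
      (L := ((canonical B).comparison V).obj K.liftData.functor)
      -- `K.liftData.functor` restricts to `K.c₀` on `Cyc₀`, so the identity serves on the bottom
      -- level. As `d₀` and `e₀` are identities in the canonical pseudo-cocone, compatibility with
      -- them dictates the other two levels.
      (NatIso.ofComponents (fun x => Iso.refl (K.c₀.obj x)) ?_)
      (NatIso.ofComponents (fun x => K.d₀.app x) ?_)
      (NatIso.ofComponents (fun x => K.e₀.app x ≪≫ K.d₀.app ((face₂₀ B).obj x)) ?_)
      ?_ ?_ ?_ ?_ ?_ ?_ ?_ ?_)⟩⟩
    · rintro ⟨_, F⟩ ⟨_, G⟩ ⟨φ⟩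
      exact (Category.comp_id _).trans (Category.id_comp _).symm
    · rintro ⟨_, x⟩ ⟨_, y⟩ ⟨φ⟩
      exact K.d₀.hom.naturality (Sigma.SigmaHom.mk φ)
    · rintro ⟨_, x⟩ ⟨_, y⟩ ⟨φ⟩
      exact (K.e₀ ≪≫ Functor.isoWhiskerLeft (face₂₀ B) K.d₀).hom.naturality (Sigma.SigmaHom.mk φ)
    · ext x
      rfl
    · ext ⟨_, F, G⟩
      refine Eq.trans ?_ (Category.comp_id _).symm
      exact Iso.hom_inv_id_assoc (K.d₀.app (cyc₁ F G)) (K.d₁.hom.app (cyc₁ F G))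
    · ext x
      exact Category.comp_id _
    · ext ⟨_, F, G, H⟩
      exact (Category.assoc _ _ _).trans (K.face_face₀₁ F G H).symm
    · ext ⟨_, F, G, H⟩
      exact comp_rot_comp (d₀ := K.d₀.app (cyc₁ (F ≫ G) H)) (K.face_face₀₂ F G H)
    · ext ⟨_, F⟩
      exact (Category.id_comp _).trans (unit_face K F)
    · ext ⟨_, F, G⟩
      -- The canonical `t₀` is an inverse right unitor whiskered by `G`; naturality of `K.d₀` along
      -- that unitor transfers `d₀ s₀ = 1` from `c₁` to `c₀`.
      have h := K.d₀.hom.naturality (cycHom₁ (ρ_ F).hom (𝟙 G))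
      have e : cycHom₀ (hcomp (ρ_ F).hom (𝟙 G)) = cycHom₀ (whiskerRightIso (ρ_ F) G).hom :=
        congrArg cycHom₀ (by simp [hcomp])
      replace h : K.c₁.map _ ≫ _ = _ ≫ K.c₀.map _ :=
        h.trans (congrArg (fun t => K.d₀.hom.app (cyc₁ (F ≫ 𝟙 _) G) ≫ K.c₀.map t) e)
      exact degen_square (x := mapCycIso₀ K.c₀ (whiskerRightIso (ρ_ F) G)) h
        (K.face_degen₀₀ F G)
    · ext ⟨_, F, G⟩
      exact comp_comp_of_unit_face (K.face_degen₀₁ F G) (unit_face K (F ≫ G))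

end PseudoColimit

end BiHH

/-! ### The full rotation as a central automorphism. -/

namespace BiHH

section Twist

variable {B : Type u} [Bicategory.{w, v} B]

/-- The full rotation of a `1`-endomorphism. -/
def twistApp (x : BiHH B) : x ≅ x :=
  cellIso (λ_ x.loop).symm ≪≫ rot (𝟙 x.pt) x.loop ≪≫ cellIso (ρ_ x.loop)

theorem twistApp_hom {X : B} (F : X ⟶ X) :
    (twistApp (of F)).hom = cell (λ_ F).inv ≫ (rot (𝟙 X) F).hom ≫ cell (ρ_ F).hom := rfl

/-- Multiplicativity, applied to `rot (𝟙 X) (F ≫ G)`, breaks the full turn into two rotations, which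
are `(F, G)` and `(G, F)` up to unitors. -/
theorem rot_hom_rot_hom {X Y : B} (F : X ⟶ Y) (G : Y ⟶ X) :
    (rot F G).hom ≫ (rot G F).hom = (twistApp (of (F ≫ G))).hom := by
  have e : (λ_ (F ≫ G)).inv ≫ (α_ (𝟙 X) F G).inv = (λ_ F).inv ▷ G := by simp
  have e' : (α_ F G (𝟙 X)).inv ≫ (ρ_ (F ≫ G)).hom = F ◁ (ρ_ G).hom := by simp
  have e'' : G ◁ (λ_ F).inv ≫ (α_ G (𝟙 X) F).inv = (ρ_ G).inv ▷ F := by simp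
  rw [twistApp_hom, rot_comp]
  simp only [Category.assoc, cell_comp_assoc, ← cell_comp]
  rw [e, e', ← Category.assoc (cell ((λ_ F).inv ▷ G)), rot_naturality_left, Category.assoc,
    cell_comp_assoc, e'', ← Category.assoc (cell ((ρ_ G).inv ▷ F)), rot_naturality_left,
    Category.assoc, ← cell_comp, whiskerLeft_inv_hom, cell_id, Category.comp_id]

/-- On a `2`-morphism this is naturality of `rot` in its second variable. On `(F, G)` both sides are
the alternating composite of `(F, G)`, `(G, F)` and `(F, G)`. -/
theorem twistApp_naturality {x y : BiHH B} (m : x ⟶ y) :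
    m ≫ (twistApp y).hom = (twistApp x).hom ≫ m := by
  refine naturality_of_generators (P := 𝟭 (BiHH B)) (Q := 𝟭 (BiHH B))
    (fun x => (twistApp x).hom) ?_ ?_ m
  · intro X F G α
    change cell α ≫ (twistApp (of G)).hom = (twistApp (of F)).hom ≫ cell α
    have e : α ≫ (λ_ G).inv = (λ_ F).inv ≫ 𝟙 X ◁ α := by simp
    have e' : (ρ_ F).hom ≫ α = α ▷ 𝟙 X ≫ (ρ_ G).hom := by simp
    rw [twistApp_hom, twistApp_hom]
    simp only [Category.assoc, cell_comp_assoc, ← cell_comp]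
    rw [e, e', slide_right]
  · intro X Y F G
    change (rot F G).hom ≫ (twistApp (of (G ≫ F))).hom =
      (twistApp (of (F ≫ G))).hom ≫ (rot F G).hom
    rw [← rot_hom_rot_hom, ← rot_hom_rot_hom, Category.assoc]

variable (B) in
/-- The full rotations form an automorphism of the identity functor of `biHH(B)`. -/
def twist : Aut (𝟭 (BiHH B)) :=
  NatIso.ofComponents twistApp fun m => twistApp_naturality m

/-- The powers of the full rotation of a `1`-endomorphism. -/
def twistPow (x : BiHH B) (n : ℤ) : x ≅ x := (twist B ^ n : Aut (𝟭 (BiHH B))).app x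

theorem twistPow_zero (x : BiHH B) : (twistPow x 0).hom = 𝟙 x := rfl

theorem twistPow_naturality {x y : BiHH B} (m : x ⟶ y) (n : ℤ) :
    m ≫ (twistPow y n).hom = (twistPow x n).hom ≫ m :=
  (twist B ^ n : Aut (𝟭 (BiHH B))).hom.naturality m

theorem twistPow_add_one (x : BiHH B) (n : ℤ) :
    (twistPow x (n + 1)).hom = (twistPow x n).hom ≫ (twistApp x).hom := by
  -- Multiplication in `Aut` is composition in the reverse order, so the additional factor has to
  -- stand on the left to be applied last.
  have h : twist B ^ (n + 1) = twist B * twist B ^ n := zpow_add_one _ _ |>.trans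
    (((Commute.refl (twist B)).zpow_left n).eq)
  exact congrArg (fun t : Aut (𝟭 (BiHH B)) => t.hom.app x) h

theorem twistPow_sub_one (x : BiHH B) (n : ℤ) :
    (twistPow x (n - 1)).hom = (twistPow x n).hom ≫ (twistApp x).inv := by
  rw [Iso.eq_comp_inv, ← twistPow_add_one, sub_add_cancel]

end Twist

end BiHH

/-! ### Winding numbers in `biHH(AdjEnd)`. -/

namespace AdjEnd

/-- The number of letters `q` in a word. -/
def countQ {a : Vertex} : ∀ {b : Vertex}, Word a b → ℕ
  | _, .nil => 0
  | _, .cons p .f => countQ p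
  | _, .cons p .g => countQ p
  | _, .cons p .q => countQ p + 1

theorem countQ_comp {a b c : Vertex} (p : Word a b) (r : Word b c) :
    countQ (p.comp r) = countQ p + countQ r := by
  induction r with
  | nil => rfl
  | @cons _ _ r e ih =>
    revert e
    rintro (_ | _ | _)
    · exact ih
    · exact ih
    · exact congrArg (· + 1) ih

/-- Neither the unit nor the counit involves `q`. This makes the winding number of `(F, G)` natural
in `G`. -/
theorem countQ_eq_of_cell {a b : Vertex} {p r : Word a b} (η : Cell p r) :
    countQ p = countQ r := by
  induction η with
  | ofEq h => rw [h]
  | vcomp _ _ h h' => exact h.trans h'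
  | whiskerLeft p _ h => rw [countQ_comp, countQ_comp, h]
  | whiskerRight _ p h => rw [countQ_comp, countQ_comp, h]
  | unit => rfl
  | counit => rfl

theorem countQ_eq_of_hom {a b : AdjEnd} {p r : a ⟶ b} (η : p ⟶ r) : countQ p = countQ r := by
  obtain ⟨η⟩ := η
  exact countQ_eq_of_cell η

end AdjEnd

namespace BiHH

open AdjEnd

/-- The category with one object whose group of endomorphisms is `ℤ`. -/
abbrev IntCat : Type := SingleObj (Multiplicative ℤ)

/-- The automorphism of the object of `IntCat` given by a natural number. -/
def intIso (n : ℕ) : SingleObj.star (Multiplicative ℤ) ≅ SingleObj.star (Multiplicative ℤ) where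
  hom := Multiplicative.ofAdd (n : ℤ)
  inv := Multiplicative.ofAdd (-(n : ℤ))
  hom_inv_id := by
    change Multiplicative.ofAdd (-(n : ℤ)) * Multiplicative.ofAdd (n : ℤ) = 1
    rw [← ofAdd_add, neg_add_cancel, ofAdd_zero]
  inv_hom_id := by
    change Multiplicative.ofAdd (n : ℤ) * Multiplicative.ofAdd (-(n : ℤ)) = 1
    rw [← ofAdd_add, add_neg_cancel, ofAdd_zero]

theorem intIso_add (m n : ℕ) : (intIso (m + n)).hom = (intIso m).hom ≫ (intIso n).hom := by
  change Multiplicative.ofAdd ((m + n : ℕ) : ℤ) =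
    Multiplicative.ofAdd (n : ℤ) * Multiplicative.ofAdd (m : ℤ)
  rw [← ofAdd_add, Nat.cast_add, add_comm]

/-- The winding number: the rotation `(F, G)` moves the letters `q` of `G` past the base point. -/
def windingData : LiftData AdjEnd IntCat where
  obj _ := SingleObj.star _
  cell _ := 𝟙 _
  rot _ G := intIso (countQ G)
  cell_id _ := rfl
  cell_comp _ _ := (Category.comp_id _).symm
  rot_naturality α β := by
    rw [Category.comp_id, Category.id_comp, countQ_eq_of_hom β]
  rot_comp F G H := by
    have h : (intIso (countQ (G ≫ H))).hom = (intIso (countQ H)).hom ≫ (intIso (countQ G)).hom := by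
      rw [← intIso_add, Nat.add_comm]
      exact congrArg (fun n => (intIso n).hom) (countQ_comp G H)
    simpa using h
  rot_id _ := by
    rw [Category.comp_id]
    rfl

/-- The functor from `biHH(AdjEnd)` to `ℤ` given by the winding numbers. -/
def winding : BiHH AdjEnd ⥤ IntCat := windingData.functor

/-- The winding number of a morphism of `biHH(AdjEnd)`. -/
def windingNumber {x y : BiHH AdjEnd} (m : x ⟶ y) : ℤ :=
  Multiplicative.toAdd (show Multiplicative ℤ from winding.map m)

theorem windingNumber_comp {x y z : BiHH AdjEnd} (m : x ⟶ y) (n : y ⟶ z) :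
    windingNumber (m ≫ n) = windingNumber m + windingNumber n :=
  (congrArg (fun t : Multiplicative ℤ => Multiplicative.toAdd t) (winding.map_comp m n)).trans
    (add_comm _ _)

theorem windingNumber_cell {X : AdjEnd} {F G : X ⟶ X} (α : F ⟶ G) :
    windingNumber (cell α) = 0 := rfl

/-- Only the factor `rot (𝟙 X) F` contributes, and it moves every letter of `F` past the base point.
-/
theorem windingNumber_twistApp {X : AdjEnd} (F : X ⟶ X) :
    windingNumber (twistApp (of F)).hom = countQ F := by
  rw [twistApp_hom, windingNumber_comp, windingNumber_comp, windingNumber_cell, windingNumber_cell,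
    zero_add, add_zero]
  rfl

theorem windingNumber_twistPow {X : AdjEnd} (F : X ⟶ X) (n : ℤ) :
    windingNumber (twistPow (of F) n).hom = n * countQ F := by
  induction n using Int.induction_on with
  | zero =>
    rw [zero_mul]
    rfl
  | succ k ih =>
    rw [twistPow_add_one, windingNumber_comp, ih, windingNumber_twistApp, add_mul, one_mul]
  | pred k ih =>
    -- One more turn leads from exponent `-k - 1` back to `-k`; the claim is obtained by solving
    -- this relation.
    have h := windingNumber_comp (twistPow (of F) (-(k : ℤ) - 1)).hom (twistApp (of F)).hom
    rw [← twistPow_add_one, sub_add_cancel, ih, windingNumber_twistApp] at h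
    rw [sub_mul, one_mul, h, add_sub_cancel_right]

end BiHH

/-! ### Uniqueness of `2`-morphisms out of the identity of `0`. -/

namespace AdjEnd

/-- The initial word among the words without `q` that begin at `0` and end at a given vertex. -/
def initialWord : ∀ b : AdjEnd, zero ⟶ b
  | .zero => Quiver.Path.nil
  | .one => f

/-- The canonical `2`-morphisms from the initial words to a word (none if `q` occurs in it). -/
def Cone : ∀ {b : Vertex} (p : Word .zero b),
    Set (@Quiver.Hom (zero ⟶ (show AdjEnd from b)) _ (initialWord b) p)
  | _, .nil => {𝟙 (𝟙 zero)}
  | _, .cons p .f => (fun k : 𝟙 zero ⟶ (show zero ⟶ zero from p) =>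
      (k ▷ f : (𝟙 zero ≫ f : zero ⟶ one) ⟶ _)) '' Cone p
  -- Whiskering by `g` yields a `2`-morphism out of `f ≫ g`, whereas the initial word at `0` is `𝟙
  -- zero`; the unit bridges the two.
  | _, .cons p .g => (fun k : f ⟶ (show zero ⟶ one from p) =>
      (u ≫ k ▷ g : (𝟙 zero : zero ⟶ zero) ⟶ _)) '' Cone p
  | _, .cons _ .q => ∅

theorem cone_subsingleton : ∀ {b : Vertex} (p : Word .zero b), (Cone p).Subsingleton
  | _, .nil => Set.subsingleton_singleton
  | _, .cons p .f => (cone_subsingleton p).image _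
  | _, .cons p .g => (cone_subsingleton p).image _
  | _, .cons _ .q => Set.subsingleton_empty

theorem comp_eqToHom_mem_cone {b : AdjEnd} {p r : zero ⟶ b} (h : p = r) {k : initialWord b ⟶ p}
    (hk : k ∈ Cone p) : k ≫ eqToHom h ∈ Cone r := by
  subst h
  simpa using hk

/-- `2`-morphisms under which the canonical `2`-morphisms are stable. -/
def PreservesCones {a b : AdjEnd} {r s : a ⟶ b} (η : r ⟶ s) : Prop :=
  ∀ (x : zero ⟶ a) (k : initialWord b ⟶ x ≫ r), k ∈ Cone (x ≫ r) → k ≫ x ◁ η ∈ Cone (x ≫ s)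

theorem PreservesCones.comp {a b : AdjEnd} {r s t : a ⟶ b} {η : r ⟶ s} {θ : s ⟶ t}
    (h : PreservesCones η) (h' : PreservesCones θ) : PreservesCones (η ≫ θ) := by
  intro x k hk
  rw [whiskerLeft_comp, ← Category.assoc]
  exact h' x _ (h x k hk)

theorem preservesCones_eqToHom {a b : AdjEnd} {r s : a ⟶ b} (h : r = s) :
    PreservesCones (eqToHom h) := by
  subst h
  intro x k hk
  simpa using hk

/-- The prefix `x` in `PreservesCones` is arbitrary, so `p` is absorbed into it. -/
theorem PreservesCones.whiskerLeft {a b c : AdjEnd} (p : a ⟶ b) {r s : b ⟶ c} {η : r ⟶ s}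
    (h : PreservesCones η) : PreservesCones (p ◁ η) := by
  intro x k hk
  have h₁ := comp_eqToHom_mem_cone (Quiver.Path.comp_assoc x p r).symm hk
  have h₂ := comp_eqToHom_mem_cone (Quiver.Path.comp_assoc x p s) (h (x ≫ p) _ h₁)
  have e : x ◁ p ◁ η = (α_ x p r).inv ≫ (x ≫ p) ◁ η ≫ (α_ x p s).hom := by simp
  have e' : (k ≫ (α_ x p r).inv ≫ (x ≫ p) ◁ η ≫ (α_ x p s).hom) =
      ((k ≫ (α_ x p r).inv) ≫ (x ≫ p) ◁ η) ≫ (α_ x p s).hom := by simp only [Category.assoc]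
  rw [e, e']
  exact h₂

theorem PreservesCones.whiskerRight_f {a : AdjEnd} {r s : a ⟶ zero} {η : r ⟶ s}
    (h : PreservesCones η) : PreservesCones (η ▷ f) := by
  rintro x k ⟨k', hk', rfl⟩
  refine ⟨k' ≫ x ◁ η, h x k' hk', ?_⟩
  have e : x ◁ η ▷ f = (α_ x r f).inv ≫ (x ◁ η) ▷ f ≫ (α_ x s f).hom := by simp
  -- Composition of paths recurses on its second argument, so associators ending in a single letter
  -- are identities by definition.
  have e₁ : (α_ x r f).inv = 𝟙 _ := rfl
  have e₂ : (α_ x s f).hom = 𝟙 _ := rfl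
  refine (comp_whiskerRight k' (x ◁ η) f).trans (congrArg (k' ▷ f ≫ ·) ?_)
  refine Eq.trans ?_ e.symm
  rw [e₁, e₂]
  exact ((Category.id_comp _).trans (Category.comp_id _)).symm

theorem PreservesCones.whiskerRight_g {a : AdjEnd} {r s : a ⟶ one} {η : r ⟶ s}
    (h : PreservesCones η) : PreservesCones (η ▷ g) := by
  rintro x k ⟨k', hk', rfl⟩
  refine ⟨k' ≫ x ◁ η, h x k' hk', ?_⟩
  have e : x ◁ η ▷ g = (α_ x r g).inv ≫ (x ◁ η) ▷ g ≫ (α_ x s g).hom := by simp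
  have e₁ : (α_ x r g).inv = 𝟙 _ := rfl
  have e₂ : (α_ x s g).hom = 𝟙 _ := rfl
  refine Eq.trans ?_ (Category.assoc _ _ _).symm
  refine congrArg (u ≫ ·) ((comp_whiskerRight k' (x ◁ η) g).trans (congrArg (k' ▷ g ≫ ·) ?_))
  refine Eq.trans ?_ e.symm
  rw [e₁, e₂]
  exact ((Category.id_comp _).trans (Category.comp_id _)).symm

/-- A word ending in `q` has an empty `Cone`, so there is nothing to preserve. -/
theorem preservesCones_of_q {a : AdjEnd} {r s : a ⟶ zero} (η : r ≫ q ⟶ s ≫ q) :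
    PreservesCones η := fun _ _ hk => hk.elim

/-- The type of `2`-morphisms between two words. -/
abbrev TwoHom (a b : AdjEnd) (r s : a ⟶ b) : Type := r ⟶ s

theorem PreservesCones.whiskerRight_nil {a b : AdjEnd} {r s : a ⟶ b} {η : r ⟶ s}
    (h : PreservesCones η) : PreservesCones (η ▷ 𝟙 b) := by
  rw [Bicategory.whiskerRight_id]
  exact (preservesCones_eqToHom (Strict.comp_id r)).comp
    (h.comp (preservesCones_eqToHom (Strict.comp_id s).symm))

theorem PreservesCones.whiskerRight_comp {a b c d : AdjEnd} {r s : a ⟶ b} {η : r ⟶ s}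
    (p : b ⟶ c) (l : c ⟶ d) (h : PreservesCones ((η ▷ p) ▷ l)) :
    PreservesCones (η ▷ (p ≫ l)) := by
  rw [Bicategory.whiskerRight_comp]
  exact (preservesCones_eqToHom (Strict.assoc r p l).symm).comp
    (h.comp (preservesCones_eqToHom (Strict.assoc s p l)))

/-- `Cone` is defined by recursion on the last letter, so `p` is appended one letter at a time. -/
theorem PreservesCones.whiskerRight {a b c : Vertex} {r s : Word a b} {η : TwoHom a b r s}
    (h : @PreservesCones a b r s η) (p : Word b c) :
    @PreservesCones a c (r.comp p) (s.comp p) (@whiskerR a b c r s η p) := by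
  induction p with
  | nil => exact h.whiskerRight_nil
  | @cons c d p l ih =>
    refine @PreservesCones.whiskerRight_comp a b c d r s η p (letter l) ?_
    revert ih l
    rintro (_ | _ | _) ih
    · exact ih.whiskerRight_f
    · exact ih.whiskerRight_g
    · exact preservesCones_of_q _

/-- Interchange of `k` and `u`. The left side is the canonical `2`-morphism of `x ≫ f ≫ g` built
from `k`, so this is stability under the unit. -/
theorem unit_whisker {x : zero ⟶ zero} (k : 𝟙 zero ⟶ x) :
    u ≫ (λ_ (f ≫ g)).inv ≫ (α_ (𝟙 zero) f g).inv ≫ k ▷ f ▷ g ≫ (α_ x f g).hom =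
      k ≫ (ρ_ x).inv ≫ x ◁ u := by
  have h := whisker_exchange k u
  have h' : k ≫ (ρ_ x).inv ≫ x ◁ u = (ρ_ (𝟙 zero)).inv ≫ k ▷ 𝟙 zero ≫ x ◁ u := by simp
  rw [h', ← h, ← unitors_inv_equal]
  simp

/-- Interchange moves the counit in front of `k`, where a triangle identity cancels it against `u`.
This is stability under the counit. -/
theorem counit_whisker {x : zero ⟶ one} (k : f ⟶ x) :
    (λ_ f).inv ≫ (u ≫ k ▷ g) ▷ f ≫ (α_ x g f).hom ≫ x ◁ c ≫ (ρ_ x).hom = k := by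
  calc
    _ = (λ_ f).inv ≫ u ▷ f ≫ (α_ f g f).hom ≫ (k ▷ (g ≫ f) ≫ x ◁ c) ≫ (ρ_ x).hom := by simp
    _ = (λ_ f).inv ≫ leftZigzag u c ≫ (ρ_ f).hom ≫ k := by
      rw [← whisker_exchange, leftZigzag]
      simp [bicategoricalComp]
    _ = _ := by
      have h : leftZigzag u c = (λ_ f).hom ≫ (ρ_ f).inv := adj.left_triangle
      rw [h]
      simp

theorem preservesCones_unit : PreservesCones u := by
  intro x k hk
  refine ⟨k ▷ f, ⟨k, hk, rfl⟩, ?_⟩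
  have h := unit_whisker (x := x) k
  refine Eq.trans (Eq.trans ?_ h) (congrArg (k ≫ ·) (Category.id_comp _))
  exact congrArg (u ≫ ·) ((Category.id_comp _).trans
    ((Category.id_comp _).trans (Category.comp_id _))).symm

theorem preservesCones_counit : PreservesCones c := by
  rintro x _ ⟨_, ⟨k, hk, rfl⟩, rfl⟩
  have h := counit_whisker (x := x) k
  refine (congrArg (· ∈ Cone x) (Eq.trans ?_ h)).mpr hk
  exact ((Category.id_comp _).trans (congrArg ((u ≫ k ▷ g) ▷ f ≫ ·)
    ((Category.id_comp _).trans (Category.comp_id _)))).symm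

theorem preservesCones_mk {a b : Vertex} {r s : Word a b} (η : Cell r s) :
    @PreservesCones a b r s (mk η) := by
  induction η with
  | @ofEq a b p r h =>
    exact (congrArg PreservesCones (@mk_ofEq a b p r h)).mpr (preservesCones_eqToHom _)
  | vcomp _ _ h h' => exact h.comp h'
  | whiskerLeft p _ h => exact h.whiskerLeft p
  | whiskerRight _ p h => exact h.whiskerRight p
  | unit => exact preservesCones_unit
  | counit => exact preservesCones_counit

theorem preservesCones {a b : AdjEnd} {r s : a ⟶ b} (η : r ⟶ s) : PreservesCones η := by
  obtain ⟨η⟩ := η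
  exact preservesCones_mk η

/-- The canonical `2`-morphism of the empty word is its identity, so stability under `η` puts `η`
itself, up to a unitor, into a set with at most one element. -/
instance hom_id_subsingleton (w : zero ⟶ zero) : Subsingleton (𝟙 zero ⟶ w) := by
  have h (η : 𝟙 zero ⟶ w) : (ρ_ (𝟙 zero)).inv ≫ 𝟙 zero ◁ η ∈ Cone (𝟙 zero ≫ w) :=
    preservesCones η (𝟙 zero) (ρ_ (𝟙 zero)).inv rfl
  refine ⟨fun η θ => ?_⟩
  have := (cancel_epi (ρ_ (𝟙 zero)).inv).1 (cone_subsingleton _ (h η) (h θ))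
  simpa using this

end AdjEnd

/-! ### Inserting letters behind a loop and rotating some of them to the front. -/

namespace BiHH

section Spin

variable {B : Type u} [Bicategory.{w, v} B] {X Y Z : B}

/-- The morphism `Q → Q ≫ S ≫ R ≅ R ≫ Q ≫ S` of `biHH(B)` given by a `2`-morphism `𝟙 ⟶ S ≫ R`. -/
def spin (Q : X ⟶ X) (R : Y ⟶ X) (S : X ⟶ Y) (η : 𝟙 X ⟶ S ≫ R) : of Q ⟶ of (R ≫ Q ≫ S) :=
  cell ((ρ_ Q).inv ≫ Q ◁ η ≫ (α_ Q S R).inv) ≫ (rot (Q ≫ S) R).hom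

theorem spin_comp_cell (Q : X ⟶ X) {R R' : Y ⟶ X} {S S' : X ⟶ Y} (η : 𝟙 X ⟶ S ≫ R) (α : R ⟶ R')
    (β : S ⟶ S') : spin Q R S η ≫ cell (α ▷ (Q ≫ S) ≫ R' ◁ Q ◁ β) =
      spin Q R' S' (η ≫ β ▷ R ≫ S' ◁ α) := by
  unfold spin
  rw [Category.assoc, ← rot_naturality, cell_comp_assoc]
  congr 2
  simp

/-- Rotating `R` and then `G` to the front is a single rotation of `G ≫ R`, by multiplicativity. So
rotating a tail of the inserted letters does not change the shape of the morphism. -/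
theorem spin_comp_rot (Q : X ⟶ X) (R : Z ⟶ X) (S : X ⟶ Y) (G : Y ⟶ Z) (η : 𝟙 X ⟶ (S ≫ G) ≫ R) :
    spin Q R (S ≫ G) η ≫ cell (R ◁ (α_ Q S G).inv ≫ (α_ R (Q ≫ S) G).inv) ≫
      (rot (R ≫ Q ≫ S) G).hom ≫ cell (α_ G R (Q ≫ S)).inv =
    spin Q (G ≫ R) S (η ≫ (α_ S G R).hom) := by
  unfold spin
  rw [rot_conj_left (α_ Q S G).symm R]
  simp only [Category.assoc, cell_comp_assoc]
  have e : R ◁ (α_ Q S G).symm.inv ≫ R ◁ (α_ Q S G).inv ≫ (α_ R (Q ≫ S) G).inv =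
      (α_ R (Q ≫ S) G).inv ≫ 𝟙 (R ≫ Q ≫ S) ▷ G := by simp
  rw [e, slide_comp]
  have e' : (α_ G R (Q ≫ S)).hom ≫ G ◁ 𝟙 (R ≫ Q ≫ S) ≫ (α_ G R (Q ≫ S)).inv = 𝟙 _ := by simp
  rw [e', cell_id, Category.comp_id]
  congr 2
  simp

/-- By `spin_comp_rot`, `F` has reached the front through the rotation `(R ≫ Q ≫ S, F)`. Sending it
back to the end completes a full turn, which is central and can be moved to the start. -/
theorem spin_comp_rot_right (Q : X ⟶ X) (F : Z ⟶ Y) (R : Y ⟶ X) (S : X ⟶ Z)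
    (η : 𝟙 X ⟶ S ≫ F ≫ R) :
    spin Q (F ≫ R) S η ≫ cell (α_ F R (Q ≫ S)).hom ≫ (rot F (R ≫ Q ≫ S)).hom =
      (twistApp (of Q)).hom ≫ spin Q R (S ≫ F) (η ≫ (α_ S F R).inv) ≫
        cell (R ◁ (α_ Q S F).inv ≫ (α_ R (Q ≫ S) F).inv) := by
  have h := spin_comp_rot Q R S F (η ≫ (α_ S F R).inv)
  rw [Category.assoc, Iso.inv_hom_id, Category.comp_id] at h
  rw [← h]
  simp only [Category.assoc, cell_comp_assoc]
  rw [Iso.inv_hom_id, cell_id, Category.id_comp, rot_hom_rot_hom, twistApp_naturality,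
    ← Category.assoc, twistApp_naturality, Category.assoc]

end Spin

end BiHH

/-! ### The letter `q` separates `2`-morphisms. -/

namespace AdjEnd

/-- The marked `q` lies on one side of the cut between `p` and `r`. Last letters are removed from
`r` and `B` together: if `B` runs out, the `q` is in `r`; if `r` runs out, it is in `p`. -/
theorem comp_q_comp_eq_comp {a b c : Vertex} (A : Word a .zero) (B : Word .zero c) (p : Word a b)
    (r : Word b c) (h : A.comp ((letter .q).comp B) = p.comp r) :
    (∃ A₀ : Word b .zero, A = p.comp A₀ ∧ r = A₀.comp ((letter .q).comp B)) ∨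
      ∃ B₀ : Word .zero b, p = A.comp ((letter .q).comp B₀) ∧ B = B₀.comp r := by
  induction r with
  | nil => exact Or.inr ⟨B, h.symm, rfl⟩
  | @cons d e r l ih =>
    cases B with
    | nil =>
      obtain rfl := Quiver.Path.obj_eq_of_cons_eq_cons h
      refine Or.inl ⟨r, eq_of_heq (Quiver.Path.heq_of_cons_eq_cons h), ?_⟩
      obtain rfl := eq_of_heq (Quiver.Path.hom_heq_of_cons_eq_cons h)
      rfl
    | cons B l' =>
      obtain rfl := Quiver.Path.obj_eq_of_cons_eq_cons h
      have h₁ := eq_of_heq (Quiver.Path.heq_of_cons_eq_cons h)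
      obtain rfl := eq_of_heq (Quiver.Path.hom_heq_of_cons_eq_cons h)
      obtain ⟨A₀, hA, hr⟩ | ⟨B₀, hp, hB⟩ := ih B h₁
      · exact Or.inl ⟨A₀, hA, congrArg (fun p => Quiver.Path.cons p l') hr⟩
      · exact Or.inr ⟨B₀, hp, congrArg (fun p => Quiver.Path.cons p l') hB⟩

theorem comp_q_comp_eq_comp' {a b c : AdjEnd} (A : a ⟶ zero) (B : zero ⟶ c) (p : a ⟶ b)
    (r : b ⟶ c) (h : A ≫ q ≫ B = p ≫ r) :
    (∃ A₀ : b ⟶ zero, A = p ≫ A₀ ∧ r = A₀ ≫ q ≫ B) ∨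
      ∃ B₀ : zero ⟶ b, p = A ≫ q ≫ B₀ ∧ B = B₀ ≫ r :=
  comp_q_comp_eq_comp A B p r h

/-- `2`-morphisms that act separately on the two sides of every letter `q` of their source. -/
def Splits {a b : AdjEnd} {p r : a ⟶ b} (η : p ⟶ r) : Prop :=
  ∀ (A : a ⟶ zero) (B : zero ⟶ b) (h : A ≫ q ≫ B = p),
    ∃ (A' : a ⟶ zero) (B' : zero ⟶ b) (h' : A' ≫ q ≫ B' = r) (α : A ⟶ A') (β : B ⟶ B'),
      eqToHom h ≫ η = (α ▷ (q ≫ B) ≫ A' ◁ q ◁ β) ≫ eqToHom h'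

theorem splits_eqToHom {a b : AdjEnd} {p r : a ⟶ b} (h : p = r) : Splits (eqToHom h) := by
  subst h
  intro A B h
  exact ⟨A, B, h, 𝟙 A, 𝟙 B, by simp⟩

theorem Splits.comp {a b : AdjEnd} {p r s : a ⟶ b} {η : p ⟶ r} {θ : r ⟶ s} (hη : Splits η)
    (hθ : Splits θ) : Splits (η ≫ θ) := by
  intro A B h
  obtain ⟨A₁, B₁, h₁, α₁, β₁, e₁⟩ := hη A B h
  obtain ⟨A₂, B₂, h₂, α₂, β₂, e₂⟩ := hθ A₁ B₁ h₁
  refine ⟨A₂, B₂, h₂, α₁ ≫ α₂, β₁ ≫ β₂, ?_⟩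
  rw [reassoc_of% e₁, e₂]
  simp only [comp_whiskerRight, whiskerLeft_comp, Category.assoc]
  rw [whisker_exchange_assoc]

theorem eqToHom_assoc_four {a b : AdjEnd} (R : a ⟶ zero) (S : zero ⟶ b) {c : AdjEnd} (G : b ⟶ c)
    (h : R ≫ q ≫ S ≫ G = (R ≫ q ≫ S) ≫ G) :
    eqToHom h = R ◁ (α_ q S G).inv ≫ (α_ R (q ≫ S) G).inv := by
  have e₁ : (α_ q S G).inv = eqToHom (Strict.assoc q S G).symm := rfl
  have e₂ : (α_ R (q ≫ S) G).inv = eqToHom (Strict.assoc R (q ≫ S) G).symm := rfl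
  rw [e₁, e₂, whiskerLeft_eqToHom, eqToHom_trans]

/-- If the marked `q` lies in `r`, the splitting of `η` is used; if it lies in `p`, then `η` acts
entirely to its right. -/
theorem Splits.whiskerLeft {a b c : AdjEnd} (p : a ⟶ b) {r s : b ⟶ c} {η : r ⟶ s}
    (hη : Splits η) : Splits (p ◁ η) := by
  intro A B h
  obtain ⟨A₀, rfl, rfl⟩ | ⟨B₀, rfl, rfl⟩ := comp_q_comp_eq_comp' A B p r h
  · obtain ⟨A', B', h', α, β, e⟩ := hη A₀ B rfl
    subst h'
    refine ⟨p ≫ A', B', Strict.assoc p A' (q ≫ B'), p ◁ α, β, ?_⟩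
    rw [eqToHom_refl, eqToHom_refl, Category.id_comp, Category.comp_id] at e
    rw [e]
    change (α_ p A₀ (q ≫ B)).hom ≫ _ = _ ≫ (α_ p A' (q ≫ B')).hom
    simp
  · have h' : A ≫ q ≫ B₀ ≫ s = (A ≫ q ≫ B₀) ≫ s := by
      rw [Strict.assoc, Strict.assoc]
    refine ⟨A, B₀ ≫ s, h', 𝟙 A, B₀ ◁ η, ?_⟩
    rw [eqToHom_assoc_four, eqToHom_assoc_four]
    simp

theorem Splits.whiskerRight {a b c : AdjEnd} {r s : a ⟶ b} {η : r ⟶ s} (hη : Splits η)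
    (p : b ⟶ c) : Splits (η ▷ p) := by
  intro A B h
  obtain ⟨A₀, rfl, rfl⟩ | ⟨B₀, rfl, rfl⟩ := comp_q_comp_eq_comp' A B r p h
  · refine ⟨s ≫ A₀, B, Strict.assoc s A₀ (q ≫ B), η ▷ A₀, 𝟙 B, ?_⟩
    change (α_ r A₀ (q ≫ B)).hom ≫ _ = _ ≫ (α_ s A₀ (q ≫ B)).hom
    simp
  · obtain ⟨A', B', h', α, β, e⟩ := hη A B₀ rfl
    subst h'
    have h' : A' ≫ q ≫ B' ≫ p = (A' ≫ q ≫ B') ≫ p := by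
      rw [Strict.assoc, Strict.assoc]
    refine ⟨A', B' ≫ p, h', α, β ▷ p, ?_⟩
    rw [eqToHom_refl, eqToHom_refl, Category.id_comp, Category.comp_id] at e
    rw [eqToHom_assoc_four, eqToHom_assoc_four, e]
    simp

theorem countQ_comp_q_comp {a b : AdjEnd} (A : a ⟶ zero) (B : zero ⟶ b) :
    countQ (A ≫ q ≫ B) = countQ A + (1 + countQ B) :=
  (countQ_comp A (q ≫ B)).trans (congrArg (countQ A + ·) (countQ_comp q B))

theorem splits_of_countQ_eq_zero {a b : AdjEnd} {p r : a ⟶ b} (η : p ⟶ r) (hp : countQ p = 0) :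
    Splits η := by
  intro A B h
  have h' := countQ_comp_q_comp A B
  rw [h, hp] at h'
  omega

/-- This is where the freeness of `q` enters: the sources of the unit and the counit contain no `q`,
so the condition is empty for them. -/
theorem splits_mk {a b : Vertex} {r s : Word a b} (η : Cell r s) : @Splits a b r s (mk η) := by
  induction η with
  | @ofEq a b p r h => exact (congrArg Splits (@mk_ofEq a b p r h)).mpr (splits_eqToHom _)
  | vcomp _ _ h h' => exact h.comp h'
  | whiskerLeft p _ h => exact h.whiskerLeft p
  | whiskerRight _ p h => exact h.whiskerRight p
  | unit => exact splits_of_countQ_eq_zero _ rfl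
  | counit => exact splits_of_countQ_eq_zero _ rfl

theorem splits {a b : AdjEnd} {r s : a ⟶ b} (η : r ⟶ s) : Splits η := by
  obtain ⟨η⟩ := η
  exact splits_mk η

end AdjEnd

/-! ### The normal form of morphisms out of `q`. -/

namespace BiHH

open AdjEnd

theorem twistApp_inv_naturality {B : Type u} [Bicategory.{w, v} B] {x y : BiHH B} (m : x ⟶ y) :
    m ≫ (twistApp y).inv = (twistApp x).inv ≫ m := by
  rw [Iso.eq_inv_comp, ← Category.assoc, ← twistApp_naturality, Category.assoc, Iso.hom_inv_id,
    Category.comp_id]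

/-- The morphisms from `q` that are composites of a power of the full rotation, the insertion of
letters by a `2`-morphism `𝟙 ⟶ S ≫ R`, and the rotation of the letters in `R` to the front. -/
def IsSpin {X : AdjEnd} {F : X ⟶ X} (m : of q ⟶ of F) : Prop :=
  ∃ (R : X ⟶ zero) (S : zero ⟶ X) (η : 𝟙 zero ⟶ S ≫ R) (h : R ≫ q ≫ S = F) (n : ℤ),
    m = (twistPow (of q) n).hom ≫ spin q R S η ≫ cell (eqToHom h)

theorem isSpin_id : IsSpin (𝟙 (of q)) := by
  -- With nothing inserted, the rotation is along a unit, and `rot_id` reduces it to unitors.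
  refine ⟨𝟙 zero, 𝟙 zero, (λ_ (𝟙 zero)).inv, rfl, 0, ?_⟩
  have h := rot_id (q ≫ 𝟙 zero)
  rw [twistPow_zero, Category.id_comp]
  unfold spin
  refine Eq.trans ?_ (Category.assoc _ _ _).symm
  refine Eq.trans ?_ (congrArg (cell _ ≫ ·) h).symm
  refine Eq.trans ?_ (cell_comp _ _)
  refine (cell_id _).symm.trans (congrArg cell ?_)
  have e : (ρ_ q).inv ≫ q ◁ (λ_ (𝟙 zero)).inv ≫ (α_ q (𝟙 zero) (𝟙 zero)).inv =
    (ρ_ q).inv ≫ (ρ_ (q ≫ 𝟙 zero)).inv := by simp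
  have e' : ((ρ_ q).inv ≫ (ρ_ (q ≫ 𝟙 zero)).inv) ≫ (ρ_ (q ≫ 𝟙 zero)).hom = (ρ_ q).inv := by simp
  exact ((congrArg (· ≫ (ρ_ (q ≫ 𝟙 zero)).hom) e).trans e').symm

/-- As `α` acts separately on both sides of the marked `q`, naturality of the rotation absorbs it
into `η`. -/
theorem IsSpin.comp_cell {X : AdjEnd} {F G : X ⟶ X} {m : of q ⟶ of F} (hm : IsSpin m)
    (α : F ⟶ G) : IsSpin (m ≫ cell α) := by
  obtain ⟨R, S, η, h, n, rfl⟩ := hm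
  obtain ⟨R', S', h', α', β', e⟩ := splits α R S h
  refine ⟨R', S', η ≫ β' ▷ R ≫ S' ◁ α', h', n, ?_⟩
  rw [Category.assoc, Category.assoc, ← cell_comp, e, cell_comp, ← Category.assoc (spin _ _ _ _),
    spin_comp_cell]

theorem IsSpin.comp_twistApp_inv {X : AdjEnd} {F : X ⟶ X} {m : of q ⟶ of F} (hm : IsSpin m) :
    IsSpin (m ≫ (twistApp (of F)).inv) := by
  obtain ⟨R, S, η, h, n, rfl⟩ := hm
  refine ⟨R, S, η, h, n - 1, ?_⟩
  rw [twistPow_sub_one, Category.assoc, twistApp_inv_naturality, Category.assoc]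

theorem IsSpin.comp_rot {X Y : AdjEnd} {F : X ⟶ Y} {G : Y ⟶ X} {m : of q ⟶ of (F ≫ G)}
    (hm : IsSpin m) : IsSpin (m ≫ (rot F G).hom) := by
  obtain ⟨R, S, η, h, n, rfl⟩ := hm
  obtain ⟨R₀, rfl, rfl⟩ | ⟨S₀, rfl, rfl⟩ := comp_q_comp_eq_comp' R S F G h
  -- The marked `q` lies in `G`, so the rotation moves it past the base point; this accounts for the
  -- exponent `n + 1`.
  · have h' : R₀ ≫ q ≫ S ≫ F = (R₀ ≫ q ≫ S) ≫ F := by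
      rw [Strict.assoc, Strict.assoc]
    refine ⟨R₀, S ≫ F, η ≫ (α_ S F R₀).inv, h', n + 1, ?_⟩
    rw [twistPow_add_one, Category.assoc (obj := BiHH AdjEnd), Category.assoc (obj := BiHH AdjEnd),
      Category.assoc (obj := BiHH AdjEnd), eqToHom_assoc_four, ← spin_comp_rot_right]
    rfl
  -- The marked `q` lies in `F`, and `G` is a tail of the letters behind it; it joins `R` without a
  -- turn.
  · refine ⟨G ≫ R, S₀, η ≫ (α_ S₀ G R).hom, Strict.assoc G R (q ≫ S₀), n, ?_⟩
    change _ = _ ≫ _ ≫ cell (α_ G R (q ≫ S₀)).hom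
    rw [← spin_comp_rot, eqToHom_assoc_four]
    simp only [Category.assoc]
    rw [← cell_comp, Iso.inv_hom_id, cell_id, Category.comp_id]

/-- The inverse of `(F, G)` is `(G, F)` followed by an inverse turn, so the case of a rotation
suffices. -/
theorem IsSpin.comp_rot_inv {X Y : AdjEnd} {F : X ⟶ Y} {G : Y ⟶ X} {m : of q ⟶ of (G ≫ F)}
    (hm : IsSpin m) : IsSpin (m ≫ (rot F G).inv) := by
  have h : (rot F G).inv = (rot G F).hom ≫ (twistApp (of (F ≫ G))).inv := by
    rw [Iso.eq_comp_inv, ← rot_hom_rot_hom, Iso.inv_hom_id_assoc]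
  rw [h, ← Category.assoc]
  exact hm.comp_rot.comp_twistApp_inv

theorem IsSpin.comp_expr {x y : BiHH AdjEnd} (e : Expr x y) :
    ∀ m : of q ⟶ x, IsSpin (F := x.loop) m →
      IsSpin (F := y.loop) (m ≫ (Quot.mk _ e : x ⟶ y)) := by
  induction e with
  | id x =>
    intro m hm
    exact (congrArg (IsSpin (F := x.loop)) (Category.comp_id m)).mpr hm
  | @comp x y z a b iha ihb =>
    intro m hm
    refine (congrArg (IsSpin (F := z.loop)) ?_).mpr (ihb _ (iha m hm))
    exact (Category.assoc m (Quot.mk _ a : x ⟶ y) (Quot.mk _ b : y ⟶ z)).symm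
  | cell α => exact fun _ hm => hm.comp_cell α
  | rot F G => exact fun _ hm => hm.comp_rot
  | rotInv F G => exact fun _ hm => hm.comp_rot_inv

theorem isSpin {X : AdjEnd} {F : X ⟶ X} (m : of q ⟶ of F) : IsSpin m := by
  obtain ⟨e⟩ := m
  refine (congrArg IsSpin ?_).mpr (IsSpin.comp_expr e (𝟙 (of q)) isSpin_id)
  exact (Category.id_comp (show of q ⟶ of F from Quot.mk _ e)).symm

theorem eq_id_of_comp_q_comp_eq_q {R S : zero ⟶ zero} (h : q = R ≫ q ≫ S) :
    R = 𝟙 zero ∧ S = 𝟙 zero := by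
  have h' : 1 = Quiver.Path.length R + (1 + Quiver.Path.length S) :=
    (congrArg Quiver.Path.length h).trans ((Quiver.Path.length_comp R _).trans
      (congrArg (Quiver.Path.length R + ·) (Quiver.Path.length_comp (letter Edge.q) S)))
  exact ⟨Quiver.Path.eq_nil_of_length_zero R (by omega),
    Quiver.Path.eq_nil_of_length_zero S (by omega)⟩

theorem spin_id (W : zero ⟶ zero) (η : 𝟙 zero ⟶ W ≫ 𝟙 zero) :
    spin q (𝟙 zero) W η ≫ cell (λ_ (q ≫ W)).hom =
      cell ((ρ_ q).inv ≫ q ◁ (η ≫ (ρ_ W).hom)) := by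
  unfold spin
  rw [Category.assoc, rot_id, ← cell_comp]
  congr 1
  simp

/-- The morphisms from `q` to a word `q ≫ W` in which `W` does not contain `q`. -/
theorem eq_twistPow_comp_cell {W : zero ⟶ zero} (hW : countQ W = 0) (k : 𝟙 zero ⟶ W)
    (m : of q ⟶ of (q ≫ W)) :
    ∃ n, m = (twistPow (of q) n).hom ≫ cell ((ρ_ q).inv ≫ q ◁ k) := by
  obtain ⟨R, S, η, h, n, rfl⟩ := isSpin m
  refine ⟨n, congrArg ((twistPow (of q) n).hom ≫ ·) ?_⟩
  -- Since `W` contains no `q`, the marked letter is the first letter of `q ≫ W`; hence `R` is empty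
  -- and `S` is `W`.
  obtain ⟨R₀, rfl, rfl⟩ | ⟨S₀, hq, hS⟩ := comp_q_comp_eq_comp' R S q W h
  · rw [countQ_comp_q_comp] at hW
    omega
  · obtain ⟨rfl, rfl⟩ := eq_id_of_comp_q_comp_eq_q hq
    obtain rfl : S = W := hS.trans (Strict.id_comp W)
    have e := spin_id S η
    rw [Subsingleton.elim (η ≫ (ρ_ S).hom) k] at e
    exact e

/-! ### Automorphisms of `∅1` and morphisms from `∅1` to `[0]1`. -/

theorem exists_eq_twistPow (m : emptyOne ⟶ emptyOne) :
    ∃ n, m = (twistPow emptyOne n).hom := by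
  obtain ⟨n, h⟩ := eq_twistPow_comp_cell (W := 𝟙 zero) rfl (𝟙 _) m
  refine ⟨n, h.trans ?_⟩
  have e : (ρ_ q).inv ≫ q ◁ 𝟙 (𝟙 zero) = 𝟙 q := by
    rw [whiskerLeft_id]
    exact Category.comp_id (ρ_ q).inv
  exact (congrArg ((twistPow (of q) n).hom ≫ cell ·) e).trans
    ((congrArg ((twistPow (of q) n).hom ≫ ·) (cell_id q)).trans (Category.comp_id _))

theorem exists_eq_twistPow_comp_unitArrow (m : emptyOne ⟶ zeroOne) :
    ∃ n, m = (twistPow emptyOne n).hom ≫ unitArrow :=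
  eq_twistPow_comp_cell (W := f ≫ g) rfl u m

theorem windingNumber_twistPow_emptyOne (n : ℤ) :
    windingNumber (twistPow emptyOne n).hom = n :=
  (windingNumber_twistPow q n).trans (mul_one n)

theorem windingNumber_comp_unitArrow (m : emptyOne ⟶ emptyOne) :
    windingNumber (m ≫ unitArrow) = windingNumber m :=
  (windingNumber_comp m unitArrow).trans (add_zero _)

/-- Every endomorphism of `∅1` is a power of the turn, and since `q` is a single letter the winding
number is the exponent. -/
theorem eq_of_windingNumber_eq {m n : emptyOne ⟶ emptyOne}
    (h : windingNumber m = windingNumber n) : m = n := by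
  obtain ⟨i, rfl⟩ := exists_eq_twistPow m
  obtain ⟨j, rfl⟩ := exists_eq_twistPow n
  rw [windingNumber_twistPow_emptyOne, windingNumber_twistPow_emptyOne] at h
  rw [h]

/-- The automorphism group of `∅1` is infinite cyclic. -/
def autEmptyOne : Aut emptyOne ≃* Multiplicative ℤ where
  toFun α := Multiplicative.ofAdd (windingNumber α.hom)
  invFun n := twistPow emptyOne (Multiplicative.toAdd n)
  left_inv _ := Iso.ext (eq_of_windingNumber_eq (windingNumber_twistPow_emptyOne _))
  right_inv n := windingNumber_twistPow_emptyOne (Multiplicative.toAdd n)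
  map_mul' α β := congrArg Multiplicative.ofAdd
    ((windingNumber_comp β.hom α.hom).trans (add_comm _ _))

/-- Existence is the normal form. For uniqueness, `unitArrow` comes from a `2`-morphism and has
winding number `0`, so the winding number of `m` is that of `α`. -/
theorem existsUnique_aut (m : emptyOne ⟶ zeroOne) :
    ∃! α : Aut emptyOne, m = α.hom ≫ unitArrow := by
  obtain ⟨n, rfl⟩ := exists_eq_twistPow_comp_unitArrow m
  refine ⟨twistPow emptyOne n, rfl, fun β hβ => Iso.ext (eq_of_windingNumber_eq ?_)⟩
  have h := congrArg windingNumber hβ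
  rw [windingNumber_comp_unitArrow] at h
  exact ((windingNumber_comp_unitArrow β.hom).symm.trans h.symm)

/-! ### The trace as a restriction, and its dependence on the choice of automorphism. -/

theorem trace_adj_eq : trace AdjEnd.adj q = unitArrow ≫ zeroOneIso.hom := by
  rw [trace_eq]
  change _ = cell ((ρ_ q).inv ≫ q ◁ u) ≫ cell (α_ q f g).inv ≫ (rot (q ≫ f) g).hom
  rw [cell_comp_assoc, Category.assoc (obj := zero ⟶ zero)]
  rfl

theorem comp_comp_of_comm {D : Type u} [Category.{v} D] {a b c d : D} {i : a ⟶ b} {s : b ⟶ b}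
    {t : a ⟶ a} {j : b ⟶ c} {k : c ⟶ d} (h : i ≫ s = t ≫ i) :
    i ≫ (s ≫ j) ≫ k = t ≫ i ≫ j ≫ k := by
  rw [Category.assoc, reassoc_of% h]

/-- Undoing `κ` shows that `m` is a power of the turn followed by the trace. Centrality moves this
power past `insertUnits`, where it is absorbed into the isomorphism. -/
theorem exists_iso_eq_insertUnits (m : emptyOne ⟶ of (g ≫ q ≫ f)) :
    ∃ j : of ((f ≫ g) ≫ q ≫ f ≫ g) ≅ of ((g ≫ f) ≫ g ≫ q ≫ f),
      m = cell (insertUnits AdjEnd.adj q) ≫ j.hom ≫ cell (applyCounit AdjEnd.adj q) := by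
  obtain ⟨n, hn⟩ := exists_eq_twistPow_comp_unitArrow (m ≫ zeroOneIso.inv)
  refine ⟨twistPow _ n ≪≫ traceIso f g q, ?_⟩
  rw [Iso.comp_inv_eq, Category.assoc, ← trace_adj_eq] at hn
  rw [hn, Iso.trans_hom]
  exact (comp_comp_of_comm (twistPow_naturality (cell (insertUnits AdjEnd.adj q)) n)).symm

theorem map_comp_inv_of_eq {C : Type u} [Category.{v} C] {D : Type u'} [Category.{v'} D]
    (P : C ⥤ D) {a b c : C} {i : a ⟶ b} {t : a ⟶ c} {κ : b ≅ c} {d : D} {e : P.obj c ≅ d}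
    {t' : P.obj a ⟶ d} (h : t = i ≫ κ.hom) (h' : P.map t ≫ e.hom = t') :
    𝟙 _ ≫ P.map i = t' ≫ e.inv ≫ P.map κ.inv := by
  subst h h'
  simp [← Functor.map_comp]

theorem conj_comp_naturality {C : Type u} [Category.{v} C] {D : Type u'} [Category.{v'} D]
    {P P' : C ⥤ D} (t : P ⟶ P') {a b : C} (κ : b ⟶ a) {d d' : D} (e : P.obj b ≅ d)
    (e' : P'.obj b ≅ d') :
    (e.inv ≫ t.app b ≫ e'.hom) ≫ e'.inv ≫ P'.map κ = (e.inv ≫ P.map κ) ≫ t.app a := by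
  simp

/-- The trace functor is isomorphic to the restriction to the morphism `∅1 → [0]1`. -/
noncomputable def trHatIso (B : Type u) [Bicategory.{w, v} B] :
    trHat B ≅ restrict B unitArrow :=
  NatIso.ofComponents
    (fun P => Arrow.isoMk (Iso.refl _)
      ((targetIso P).symm ≪≫ (map P.toPseudofunctor).mapIso zeroOneIso.symm)
      (map_comp_inv_of_eq (map P.toPseudofunctor) trace_adj_eq
        (map_trace P.toPseudofunctor AdjEnd.adj q)))
    (fun {P P'} σ => Arrow.hom_ext _ _ ((Category.comp_id _).trans (Category.id_comp _).symm)
      (conj_comp_naturality ((functorial AdjEnd B).map σ) zeroOneIso.inv (targetIso P)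
        (targetIso P')))

/-- Both functors have the same objects, so their agreement on morphisms is the naturality of the
family of identities and can be checked on generators. -/
theorem map_id_map {B : Type u} [Bicategory.{w, v} B] {x y : BiHH B} (m : x ⟶ y) :
    (map (Pseudofunctor.id B)).map m = m := by
  have h := naturality_of_generators (P := map (Pseudofunctor.id B)) (Q := 𝟭 (BiHH B))
    (fun x => 𝟙 x)
    (fun α => (Category.comp_id _).trans (Category.id_comp _).symm)
    (fun F G => by
      refine (Category.comp_id _).trans (Eq.trans ?_ (Category.id_comp _).symm)
      change cell (𝟙 _) ≫ (rot F G).hom ≫ cell (𝟙 _) = (rot F G).hom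
      rw [cell_id, cell_id, Category.id_comp, Category.comp_id]) m
  exact (Category.comp_id _).symm.trans (h.trans (Category.id_comp _))

/-- Evaluation at the identity pseudofunctor returns the arrow itself, and its winding number
determines the automorphism. -/
theorem restrict_injective :
    Function.Injective (fun α : Aut emptyOne => restrict AdjEnd (α.hom ≫ unitArrow)) := by
  intro α β h
  have h₁ := congrArg (fun T => T.obj ⟨Pseudofunctor.id AdjEnd⟩) h
  have h₂ : (map (Pseudofunctor.id AdjEnd)).map (α.hom ≫ unitArrow) =
      (map (Pseudofunctor.id AdjEnd)).map (β.hom ≫ unitArrow) := Arrow.mk_injective _ _ h₁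
  rw [map_id_map, map_id_map] at h₂
  have h₃ := congrArg windingNumber h₂
  exact Iso.ext (eq_of_windingNumber_eq ((windingNumber_comp_unitArrow α.hom).symm.trans
    (h₃.trans (windingNumber_comp_unitArrow β.hom))))

end BiHH

theorem mainTheorem10 :
    -- `biHH(B)` is the pseudo-colimit of the truncated cyclic bar construction
    (∀ (B : Type u) [Bicategory.{w, v} B] (V : Type u') [Category.{v'} V],
      ((BiHH.canonical B).comparison V).IsEquivalence) ∧
    -- the trace functor is the restriction to the morphism `∅1 → [0]1`
    (BiHH.trace AdjEnd.adj AdjEnd.q = BiHH.unitArrow ≫ BiHH.zeroOneIso.hom ∧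
      ∀ (B : Type u) [Bicategory.{w, v} B],
        ∃ e : BiHH.trHat B ≅ BiHH.restrict B BiHH.unitArrow, ∀ P : PseudoFun AdjEnd B,
          (e.hom.app P).left = 𝟙 _ ∧
          (e.hom.app P).right =
            (BiHH.targetIso P).inv ≫ (BiHH.map P.toPseudofunctor).map BiHH.zeroOneIso.inv) ∧
    -- `Aut(∅1)` is infinite cyclic
    Nonempty (Aut BiHH.emptyOne ≃* Multiplicative ℤ) ∧
    -- the morphism `∅1 → [0]1` is determined only up to a unique automorphism of `∅1`
    (∀ m : BiHH.emptyOne ⟶ BiHH.zeroOne,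
      ∃! α : Aut BiHH.emptyOne, m = α.hom ≫ BiHH.unitArrow) ∧
    -- all morphisms arise from a choice of the isomorphism in the definition of the trace
    (∀ m : BiHH.emptyOne ⟶ BiHH.of (AdjEnd.g ≫ AdjEnd.q ≫ AdjEnd.f),
      ∃ j : BiHH.of ((AdjEnd.f ≫ AdjEnd.g) ≫ AdjEnd.q ≫ AdjEnd.f ≫ AdjEnd.g) ≅
          BiHH.of ((AdjEnd.g ≫ AdjEnd.f) ≫ AdjEnd.g ≫ AdjEnd.q ≫ AdjEnd.f),
        m = BiHH.cell (BiHH.insertUnits AdjEnd.adj AdjEnd.q) ≫ j.hom ≫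
          BiHH.cell (BiHH.applyCounit AdjEnd.adj AdjEnd.q)) ∧
    -- different automorphisms of `∅1` give different functors
    Function.Injective (fun α : Aut BiHH.emptyOne =>
      BiHH.restrict AdjEnd (α.hom ≫ BiHH.unitArrow)) := by
  refine ⟨fun B _ V _ => ⟨BiHH.comparison_faithful, BiHH.comparison_full,
    BiHH.comparison_essSurj⟩, ⟨BiHH.trace_adj_eq, fun B _ => ⟨BiHH.trHatIso B, fun P => ⟨rfl, rfl⟩⟩⟩,
    ⟨BiHH.autEmptyOne⟩, BiHH.existsUnique_aut, BiHH.exists_iso_eq_insertUnits,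
    BiHH.restrict_injective⟩
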